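/- **Setting.** $\lambda$ is the security parameter and keys are $\lambda$-bit strings. An LSM store $\Lambda=(C_r,I_r,Q)$ has a randomized construction $\sigma\leftarrow C_r$, a randomized insertion $\sigma'\leftarrow I_r((k,v),\sigma)$ with $k\in\{0,1\}^\lambda$, $v\in\{0,1\}^\lambda\cup\{\bot\}$ ($\bot$ is the tombstone), and a deterministic query $Q(k,\sigma)$ that, with probability 1, returns the value inserted last for $k$, or $\bot$ if there is none. Its state contains a memory buffer, runs, one Bloom filter for each run (deterministic query, no false negatives on the keys of its run), and possibly a secret key used by the filters. The filter memory is the total length of the filter states and of that secret key. All these algorithms are efficient (polynomial size in $\lambda$ and the number of insertions). A *pseudorandom permutation* $F$ is an efficient, efficiently invertible keyed family of permutations $F_\kappa$ of $\{0,1\}^\lambda$, $\kappa\in\{0,1\}^\lambda$, such that every n.u. p.p.t. distinguisher (polynomial-size family of randomized oracle circuits) given $1^\lambda$ and oracle access to the permutation and its inverse has only negligible advantage in telling $F_\kappa$, $\kappa$ uniform, from a uniformly random permutation of $\{0,1\}^\lambda$. *Game Smash-Lsm.* The adversary $\mathcal A=(\mathcal A_C,\mathcal A_Q)$ chooses, by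 $\mathcal A_C(1^\lambda)$, a list $\mathcal L$ of $n$ key-value pairs. The challenger constructs the store and inserts the pairs of $\mathcal L$ in order. Then $\mathcal A_Q(1^\lambda,\mathcal L)$ makes at most $t$ queries $k_1,\dots,k_t$ to the oracle $\mathscr O_Q$, where $\mathscr O_Q(k)=\top$ if and only if some Bloom filter of the store is positive on $k$, and any number of queries to the oracle $\mathscr O_R$, which returns the states of all Bloom filters but not the secret key. It outputs a key $k_{\mathcal A}$ and wins if $k_{\mathcal A}$ is neither a key of $\mathcal L$ nor among $k_1,\dots,k_t$, and $\mathscr O_Q(k_{\mathcal A})=\top$. The store is *$(n,t,\varepsilon)$-secure* against Bloom filter targeting adversaries if every n.u. p.p.t. adversary (polynomial-size families of randomized (oracle) circuits) wins with probability at most $\varepsilon$ for all large enough $\lambda$. Here $n$, $t$, $\varepsilon$ may depend on $\lambda$, and $n$ is polynomially bounded. **Theorem.** Let $\Lambda$ be an LSM store that uses $m$ bits of memory for its Bloom filters, and let $\varepsilon$ bound its false positive probability: for all large enough $\lambda$, for every fixed list of $n$ pairs and every fixed key $x$ that is not in the list, after inserting the list the probability over the coins of $C_r$ and $I_r$ that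 some Bloom filter is positive on $x$ is at most $\varepsilon$. Let $F$ be a pseudorandom permutation. Then there are a negligible function $\mathrm{negl}$ and an LSM store $\Lambda'$ that is $(n,t,\varepsilon+\mathrm{negl}(\lambda))$-secure against Bloom filter targeting adversaries, that uses $m+\lambda$ bits of memory for its Bloom filters, and whose false positive probability is bounded by $\varepsilon$ in the same sense. Explicitly, $\Lambda'$ is the store that draws a uniform secret key $\kappa\in\{0,1\}^\lambda$ at construction and then runs $\Lambda$ with $F_\kappa(k)$ in place of every key $k$ on insertion and on query (to the store and to its Bloom filters). -/

import Mathlib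

open Filter

/-! ### Bits, keys, values -/

/-- Bit strings of length `n`. -/
abbrev Bits (n : ℕ) : Type := Fin n → Bool

/-- Encoding of an optional bit string by a flag bit (the wire `none`) followed by the string;
the missing value is encoded by zeros. -/
def encOpt {n : ℕ} : Option (Bits n) → (Option (Fin n) → Bool)
  | none => fun _ => false
  | some v => fun i => i.elim true v

/-- Decoding of a flag bit followed by a string. -/
def decOpt {n : ℕ} (w : Option (Fin n) → Bool) : Option (Bits n) :=
  if w none then some (fun i => w (some i)) else none

/-! ### Asymptotics -/

/-- `f` is bounded by a polynomial in the parameter `par`. -/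
def PolyBounded {ι : Type*} (par : ι → ℕ) (f : ι → ℕ) : Prop :=
  ∃ p : Polynomial ℕ, ∀ a, f a ≤ p.eval (par a)

/-- Negligible functions: eventually below every inverse power. -/
def Negligible (f : ℕ → ℝ) : Prop :=
  ∀ c : ℕ, ∀ᶠ l in atTop, |f l| ≤ ((l : ℝ) ^ c)⁻¹

/-! ### Randomized Boolean circuits with oracle gates

Non-uniform probabilistic polynomial time is modelled in the standard way, by families of
randomized Boolean (oracle) circuits of polynomial size. -/

/-- The names of the oracles available to a circuit, with their input and output wires. -/
structure OracleSig where
  Op : Type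
  dom : Op → Type
  cod : Op → Type

/-- The empty oracle signature. -/
def noOracle : OracleSig where
  Op := Empty
  dom := fun e => e.elim
  cod := fun e => e.elim

/-- Answers of (stateless) oracles of signature `S`. -/
abbrev OracleSig.Answers (S : OracleSig) : Type :=
  (o : S.Op) → (S.dom o → Bool) → (S.cod o → Bool)

/-- A query: the name of an oracle and the bits sent to it. -/
abbrev OracleSig.Query (S : OracleSig) : Type := (o : S.Op) × (S.dom o → Bool)

/-- Circuits with input wires `α` and output wires `β`. Circuits are built from constants, NAND
gates, coin tosses and oracle gates by sequential and parallel composition; `wire` permutes, copies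
and discards wires. -/
inductive Circuit (S : OracleSig) : Type → Type → Type 1
  | wire {α β : Type} (f : β → α) : Circuit S α β
  | const (b : Bool) : Circuit S Empty Unit
  | nand : Circuit S (Unit ⊕ Unit) Unit
  | coin : Circuit S Empty Unit
  | oracle (o : S.Op) : Circuit S (S.dom o) (S.cod o)
  | seq {α β γ : Type} (c : Circuit S α β) (d : Circuit S β γ) : Circuit S α γ
  | par {α β γ δ : Type} (c : Circuit S α β) (d : Circuit S γ δ) : Circuit S (α ⊕ γ) (β ⊕ δ)

namespace Circuit

/-- The number of gates. -/
def size {S : OracleSig} : {α β : Type} → Circuit S α β → ℕ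
  | _, _, wire _ => 0
  | _, _, const _ => 1
  | _, _, nand => 1
  | _, _, coin => 1
  | _, _, oracle _ => 1
  | _, _, seq c d => c.size + d.size
  | _, _, par c d => c.size + d.size

/-- The joint distribution of the output bits and of the list of oracle queries made. -/
noncomputable def run {S : OracleSig} (O : S.Answers) :
    {α β : Type} → Circuit S α β → (α → Bool) → PMF ((β → Bool) × List S.Query)
  | _, _, wire f, x => PMF.pure (x ∘ f, [])
  | _, _, const b, _ => PMF.pure (fun _ => b, [])
  | _, _, nand, x => PMF.pure (fun _ => !(x (Sum.inl ()) && x (Sum.inr ())), [])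
  | _, _, coin, _ => (PMF.uniformOfFintype Bool).bind fun b => PMF.pure (fun _ => b, [])
  | _, _, oracle o, x => PMF.pure (O o x, [⟨o, x⟩])
  | _, _, seq c d, x =>
      (c.run O x).bind fun y => (d.run O y.1).bind fun z => PMF.pure (z.1, y.2 ++ z.2)
  | _, _, par c d, x =>
      (c.run O (x ∘ Sum.inl)).bind fun y => (d.run O (x ∘ Sum.inr)).bind fun z =>
        PMF.pure (Sum.elim y.1 z.1, y.2 ++ z.2)

/-- The output distribution. -/
noncomputable def dist {S : OracleSig} (O : S.Answers) {α β : Type} (c : Circuit S α β)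
    (x : α → Bool) : PMF (β → Bool) :=
  (c.run O x).map Prod.fst

/-- The output distribution of a circuit without oracle gates. -/
noncomputable def out {α β : Type} (c : Circuit noOracle α β) (x : α → Bool) : PMF (β → Bool) :=
  c.dist (fun o : Empty => o.elim) x

end Circuit

/-! ### Pseudorandom permutations -/

/-- A length-preserving keyed permutation, for keys and inputs of equal length. -/
abbrev KeyedPerm : Type := (n : ℕ) → Bits n → Equiv.Perm (Bits n)

/-- Signature of a pair of oracles on `n`-bit strings: a permutation and its inverse. -/
def permSig (n : ℕ) : OracleSig where
  Op := Bool
  dom := fun _ => Fin n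
  cod := fun _ => Fin n

/-- The oracles `f` (gate `true`) and `f⁻¹` (gate `false`). -/
def permAnswers {n : ℕ} (f : Equiv.Perm (Bits n)) : (permSig n).Answers
  | true => fun x => f x
  | false => fun x => f.symm x

namespace KeyedPerm

/-- `F_k(x)` and `F_k⁻¹(x)` are efficiently computable from `k` and `x`. -/
def Efficient (F : KeyedPerm) : Prop :=
  (∃ c : (n : ℕ) → Circuit noOracle (Fin n ⊕ Fin n) (Fin n),
    PolyBounded id (fun n => (c n).size) ∧
      ∀ n k x, (c n).out (Sum.elim k x) = PMF.pure (F n k x)) ∧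
  (∃ c : (n : ℕ) → Circuit noOracle (Fin n ⊕ Fin n) (Fin n),
    PolyBounded id (fun n => (c n).size) ∧
      ∀ n k x, (c n).out (Sum.elim k x) = PMF.pure ((F n k).symm x))

/-- The probability that `D` outputs `1` with oracles `F_k`, `F_k⁻¹`, for a uniform key `k`. -/
noncomputable def realProb (F : KeyedPerm) {n : ℕ} (D : Circuit (permSig n) Empty Unit) : ℝ :=
  ((PMF.uniformOfFintype (Bits n)).bind fun k =>
    D.dist (permAnswers (F n k)) Empty.elim) (fun _ => true) |>.toReal

/-- The probability that `D` outputs `1` with oracles `f`, `f⁻¹`, for a uniform permutation `f`. -/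
noncomputable def idealProb {n : ℕ} (D : Circuit (permSig n) Empty Unit) : ℝ :=
  ((PMF.uniformOfFintype (Equiv.Perm (Bits n))).bind fun f =>
    D.dist (permAnswers f) Empty.elim) (fun _ => true) |>.toReal

/-- Pseudorandom permutations: efficient keyed permutations that no efficient distinguisher, with
access to the permutation and its inverse, tells from a uniformly random permutation. -/
def IsPRP (F : KeyedPerm) : Prop :=
  F.Efficient ∧
  ∀ D : (n : ℕ) → Circuit (permSig n) Empty Unit, PolyBounded id (fun n => (D n).size) →
    Negligible fun n => realProb F (D n) - idealProb (D n)

end KeyedPerm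

/-! ### LSM stores -/

/-- The key-value pairs for security parameter `l`; the value `none` is the tombstone. -/
abbrev Entry (l : ℕ) : Type := Bits l × Option (Bits l)

/-- The value written last for the key `x`, or `none` if there is none. -/
def lastValue {l : ℕ} : {i : ℕ} → (Fin i → Entry l) → Bits l → Option (Bits l)
  | 0, _, _ => none
  | i + 1, L, x =>
      if (L (Fin.last i)).1 = x then (L (Fin.last i)).2 else lastValue (fun j => L j.castSucc) x

/-- The algorithms and the memory layout of an LSM store with Bloom filters; `l` is the security
parameter (a part of the public parameters) and `i` counts the insertions made so far. The state is
a bit string. It consists of a secret key for the filters, the internal states of the Bloom filters,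
and everything else (buffer, runs, fence pointers, ...). -/
structure LSMScheme where
  /-- Length of the secret key of the filters (`0` for unkeyed filters). -/
  secretBits : ℕ → ℕ
  /-- Number of Bloom filters. -/
  numFilters : ℕ → ℕ → ℕ
  /-- Size of the `j`-th Bloom filter. -/
  filterBits : (l i : ℕ) → Fin (numFilters l i) → ℕ
  /-- Size of the rest of the state. -/
  restBits : ℕ → ℕ → ℕ
  /-- The construction algorithm. -/
  construct : (l : ℕ) → PMF (Fin (secretBits l) ⊕ ((j : Fin (numFilters l 0)) × Fin (filterBits l 0 j))
      ⊕ Fin (restBits l 0) → Bool)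
  /-- The insertion algorithm. -/
  insert : (l i : ℕ) → Entry l →
    (Fin (secretBits l) ⊕ ((j : Fin (numFilters l i)) × Fin (filterBits l i j))
      ⊕ Fin (restBits l i) → Bool) →
    PMF (Fin (secretBits l) ⊕ ((j : Fin (numFilters l (i + 1))) × Fin (filterBits l (i + 1) j))
      ⊕ Fin (restBits l (i + 1)) → Bool)
  /-- The query algorithm. -/
  query : (l i : ℕ) → Bits l →
    (Fin (secretBits l) ⊕ ((j : Fin (numFilters l i)) × Fin (filterBits l i j))
      ⊕ Fin (restBits l i) → Bool) → Option (Bits l)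
  /-- The query algorithm of the `j`-th Bloom filter: key, secret, filter state. -/
  filterQuery : (l i : ℕ) → (j : Fin (numFilters l i)) → Bits l → Bits (secretBits l) →
    Bits (filterBits l i j) → Bool
  /-- The keys held in the memory buffer. -/
  buffer : (l i : ℕ) →
    (Fin (secretBits l) ⊕ ((j : Fin (numFilters l i)) × Fin (filterBits l i j))
      ⊕ Fin (restBits l i) → Bool) → Set (Bits l)
  /-- The keys held in the run that the `j`-th Bloom filter belongs to. -/
  runKeys : (l i : ℕ) → Fin (numFilters l i) →
    (Fin (secretBits l) ⊕ ((j : Fin (numFilters l i)) × Fin (filterBits l i j))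
      ⊕ Fin (restBits l i) → Bool) → Set (Bits l)

namespace LSMScheme

/-- The bit positions of all Bloom filter states. -/
abbrev FilterIdx (Λ : LSMScheme) (l i : ℕ) : Type :=
  (j : Fin (Λ.numFilters l i)) × Fin (Λ.filterBits l i j)

/-- The bit positions of a state. -/
abbrev StateIdx (Λ : LSMScheme) (l i : ℕ) : Type :=
  Fin (Λ.secretBits l) ⊕ Λ.FilterIdx l i ⊕ Fin (Λ.restBits l i)

/-- The states after `i` insertions. -/
abbrev State (Λ : LSMScheme) (l i : ℕ) : Type := Λ.StateIdx l i → Bool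

variable (Λ : LSMScheme) {l i : ℕ}

/-- The secret key of the filters. -/
def secret (σ : Λ.State l i) : Bits (Λ.secretBits l) := fun a => σ (Sum.inl a)

/-- The internal states of all Bloom filters. -/
def filters (σ : Λ.State l i) : Λ.FilterIdx l i → Bool := fun a => σ (Sum.inr (Sum.inl a))

/-- The answer of the `j`-th Bloom filter to the key `x` in state `σ`. -/
def filterAnswer (σ : Λ.State l i) (j : Fin (Λ.numFilters l i)) (x : Bits l) : Bool :=
  Λ.filterQuery l i j x (Λ.secret σ) fun a => Λ.filters σ ⟨j, a⟩

/-- Whether some Bloom filter answers positively to the key `x` in state `σ`. -/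
def anyFilter (σ : Λ.State l i) (x : Bits l) : Bool :=
  decide (∃ j, Λ.filterAnswer σ j x = true)

/-- The memory for the Bloom filters, in bits: the filter states and the secret key. -/
def filterMemory (l i : ℕ) : ℕ := Λ.secretBits l + ∑ j, Λ.filterBits l i j

/-- The state of a new store after the insertion of the given pairs, in order. -/
noncomputable def load (l : ℕ) : {i : ℕ} → (Fin i → Entry l) → PMF (Λ.State l i)
  | 0, _ => Λ.construct l
  | i + 1, L => (load l fun j => L j.castSucc).bind fun σ => Λ.insert l i (L (Fin.last i)) σ

/-- Queries return the value written last, and `none` if there is none, with probability `1`. -/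
def Correct : Prop :=
  ∀ (l i : ℕ) (L : Fin i → Entry l), ∀ σ ∈ (Λ.load l L).support, ∀ x,
    Λ.query l i x σ = lastValue L x

/-- The buffer and the runs hold inserted keys only, all keys with a current value are held
somewhere, and the Bloom filter of a run has no false negatives. -/
def FiltersComplete : Prop :=
  ∀ (l i : ℕ) (L : Fin i → Entry l), ∀ σ ∈ (Λ.load l L).support, ∀ x,
    (x ∈ Λ.buffer l i σ → ∃ a, (L a).1 = x) ∧
    (∀ j, x ∈ Λ.runKeys l i j σ → ∃ a, (L a).1 = x) ∧
    (lastValue L x ≠ none → x ∈ Λ.buffer l i σ ∨ ∃ j, x ∈ Λ.runKeys l i j σ) ∧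
    (∀ j, x ∈ Λ.runKeys l i j σ → Λ.filterAnswer σ j x = true)

/-- All algorithms are efficient: they are computed by circuits of size polynomial in the security
parameter and the number of insertions, as are the sizes of the states. -/
structure Efficient : Prop where
  numFilters : PolyBounded (fun a : ℕ × ℕ => a.1 + a.2) fun a => Λ.numFilters a.1 a.2
  state : PolyBounded (fun a : ℕ × ℕ => a.1 + a.2) fun a => Fintype.card (Λ.StateIdx a.1 a.2)
  construct : ∃ c : (l : ℕ) → Circuit noOracle Empty (Λ.StateIdx l 0),
    PolyBounded id (fun l => (c l).size) ∧ ∀ l, (c l).out Empty.elim = Λ.construct l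
  insert : ∃ c : (l i : ℕ) →
      Circuit noOracle ((Fin l ⊕ Option (Fin l)) ⊕ Λ.StateIdx l i) (Λ.StateIdx l (i + 1)),
    PolyBounded (fun a : ℕ × ℕ => a.1 + a.2) (fun a => (c a.1 a.2).size) ∧
      ∀ (l i : ℕ) (e : Entry l) (σ : Λ.State l i),
        (c l i).out (Sum.elim (Sum.elim e.1 (encOpt e.2)) σ) = Λ.insert l i e σ
  query : ∃ c : (l i : ℕ) → Circuit noOracle (Fin l ⊕ Λ.StateIdx l i) (Option (Fin l)),
    PolyBounded (fun a : ℕ × ℕ => a.1 + a.2) (fun a => (c a.1 a.2).size) ∧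
      ∀ (l i : ℕ) (x : Bits l) (σ : Λ.State l i),
        (c l i).out (Sum.elim x σ) = PMF.pure (encOpt (Λ.query l i x σ))
  filterQuery : ∃ c : (l i : ℕ) → (j : Fin (Λ.numFilters l i)) →
      Circuit noOracle (Fin l ⊕ Fin (Λ.secretBits l) ⊕ Fin (Λ.filterBits l i j)) Unit,
    PolyBounded (fun a : (l : ℕ) × (i : ℕ) × Fin (Λ.numFilters l i) => a.1 + a.2.1)
      (fun a => (c a.1 a.2.1 a.2.2).size) ∧
      ∀ (l i : ℕ) (j : Fin (Λ.numFilters l i)) (x : Bits l) (s : Bits (Λ.secretBits l))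
        (b : Bits (Λ.filterBits l i j)),
        (c l i j).out (Sum.elim x (Sum.elim s b)) = PMF.pure fun _ => Λ.filterQuery l i j x s b

/-- LSM stores with Bloom filters. -/
structure IsLSMStore : Prop where
  correct : Λ.Correct
  filtersComplete : Λ.FiltersComplete
  efficient : Λ.Efficient

/-- Soundness of the Bloom filters of the store: after the insertion of any fixed list of `n`
pairs, any fixed key that is not in the list is positive for some filter with probability at
most `ε` (for all large enough security parameters). -/
def FalsePositiveRate (n : ℕ → ℕ) (ε : ℕ → ℝ) : Prop :=
  ∀ᶠ l in atTop, ∀ (L : Fin (n l) → Entry l) (x : Bits l), (∀ a, (L a).1 ≠ x) →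
    (((Λ.load l L).map fun σ => Λ.anyFilter σ x) true).toReal ≤ ε l

/-! ### The game -/

/-- The oracles of the game: `none` is the oracle `O_R`, without input, and `some ()` is `O_Q`. The
input of `O_Q` is a key with a flag bit; no query is made if the flag is off. -/
def smashSig (l i : ℕ) : OracleSig where
  Op := Option Unit
  dom := fun o => o.elim Empty fun _ => Option (Fin l)
  cod := fun o => o.elim (Λ.FilterIdx l i) fun _ => Unit

/-- `O_R` returns the states of all Bloom filters (and not the secret key), and `O_Q` returns
whether some Bloom filter is positive. -/
def smashAnswers (σ : Λ.State l i) : (Λ.smashSig l i).Answers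
  | none => fun _ => Λ.filters σ
  | some _ => fun w _ => (decOpt (n := l) w).elim false fun x => Λ.anyFilter σ x

/-- The key sent to `O_Q`, if any. -/
def askedKey : (Λ.smashSig l i).Query → Option (Bits l)
  | ⟨none, _⟩ => none
  | ⟨some _, w⟩ => decOpt (n := l) w

/-- The wires that carry a list of `n` key-value pairs. -/
abbrev ListIdx (l n : ℕ) : Type := Fin n × (Fin l ⊕ Option (Fin l))

/-- Encoding of a list of pairs. -/
def encList {l n : ℕ} (L : Fin n → Entry l) : ListIdx l n → Bool :=
  fun a => Sum.elim (L a.1).1 (encOpt (L a.1).2) a.2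

/-- Decoding of a list of pairs. -/
def decList {l n : ℕ} (w : ListIdx l n → Bool) : Fin n → Entry l :=
  fun a => (fun b => w (a, Sum.inl b), decOpt fun b => w (a, Sum.inr b))

/-- Bloom filter targeting adversaries: `choose` selects the list of `n` pairs that is inserted, and
`attack` gets this list and access to `O_Q` and `O_R`, and outputs a key. -/
structure Adversary (n : ℕ → ℕ) where
  choose : (l : ℕ) → Circuit noOracle Empty (ListIdx l (n l))
  attack : (l : ℕ) → Circuit (Λ.smashSig l (n l)) (ListIdx l (n l)) (Fin l)

/-- Non-uniform probabilistic polynomial time adversaries. -/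
def Adversary.Efficient {Λ : LSMScheme} {n : ℕ → ℕ} (A : Λ.Adversary n) : Prop :=
  PolyBounded id (fun l => (A.choose l).size) ∧ PolyBounded id (fun l => (A.attack l).size)

/-- The game: the adversary wins if, after at most `t` queries to `O_Q`, it outputs a key that is
not in the list, was not queried, and is positive for some Bloom filter. -/
noncomputable def smash {n : ℕ → ℕ} (A : Λ.Adversary n) (t l : ℕ) : PMF Bool :=
  ((A.choose l).out Empty.elim).bind fun w =>
    (Λ.load l (decList w)).bind fun σ =>
      ((A.attack l).run (Λ.smashAnswers σ) (encList (decList w))).bind fun r =>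
        PMF.pure (decide ((r.2.filterMap Λ.askedKey).length ≤ t ∧
          (∀ a, (decList w a).1 ≠ r.1) ∧ r.1 ∉ r.2.filterMap Λ.askedKey ∧
          Λ.anyFilter σ r.1 = true))

/-- `(n, t, ε)`-security against Bloom filter targeting adversaries. -/
def Secure (n t : ℕ → ℕ) (ε : ℕ → ℝ) : Prop :=
  ∀ A : Λ.Adversary n, A.Efficient → ∀ᶠ l in atTop, (Λ.smash A (t l) l true).toReal ≤ ε l

/-! ### The construction -/

/-- Removal of the additional secret key from a state. -/
def baseState {l s : ℕ} {β : Type} (σ : Fin (s + l) ⊕ β → Bool) : Fin s ⊕ β → Bool :=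
  Sum.elim (fun a => σ (Sum.inl (Fin.castAdd l a))) fun b => σ (Sum.inr b)

/-- The additional secret key of a state. -/
def addedKey {l s : ℕ} {β : Type} (σ : Fin (s + l) ⊕ β → Bool) : Bits l :=
  fun a => σ (Sum.inl (Fin.natAdd s a))

/-- Addition of the secret key `κ` to a state. -/
def addKey {l s : ℕ} {β : Type} (κ : Bits l) (σ : Fin s ⊕ β → Bool) : Fin (s + l) ⊕ β → Bool :=
  Sum.elim (Fin.append (fun a => σ (Sum.inl a)) κ) fun b => σ (Sum.inr b)

/-- The store that keeps a uniformly random secret key `κ` of `l` bits and applies `F_κ` to every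
key on insertion and on query. It holds the key `x` where the original store holds `F_κ x`. -/
noncomputable abbrev withPerm (Λ : LSMScheme) (F : KeyedPerm) : LSMScheme where
  secretBits := fun l => Λ.secretBits l + l
  numFilters := Λ.numFilters
  filterBits := Λ.filterBits
  restBits := Λ.restBits
  construct := fun l => (PMF.uniformOfFintype (Bits l)).bind fun κ =>
    (Λ.construct l).map (addKey κ)
  insert := fun l i e σ =>
    (Λ.insert l i (F l (addedKey σ) e.1, e.2) (baseState σ)).map (addKey (addedKey σ))
  query := fun l i x σ => Λ.query l i (F l (addedKey σ) x) (baseState σ)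
  filterQuery := fun l i j x s b =>
    Λ.filterQuery l i j (F l (fun a => s (Fin.natAdd (Λ.secretBits l) a)) x)
      (fun a => s (Fin.castAdd l a)) b
  buffer := fun l i σ => {x | F l (addedKey σ) x ∈ Λ.buffer l i (baseState σ)}
  runKeys := fun l i j σ => {x | F l (addedKey σ) x ∈ Λ.runKeys l i j (baseState σ)}

end LSMScheme

/-! ### Uniform distributions -/

/-! Loading the new store is the same as drawing `κ`, loading the old store with the keys renamed by
`F_κ`, and attaching `κ` to the state (`load_withPerm`). Since `F_κ` is injective, renaming
preserves equality of keys. Correctness, completeness of the filters and the false positive bound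
therefore hold for each fixed `κ`, and the last survives averaging over `κ`.

For security, drop the limit on the number of queries, which can only help the adversary, and
replace `F_κ` by a uniform permutation `f` (`permGame`). Fix the list and the loaded state `σ`. The
posterior weight of `f` depends only on its values on the keys of the list. Every filter state is
then fixed, so reading the filters reveals nothing more about `f`, and a query on `x` reveals only
one bit depending on `f x`. Keys not yet seen remain exchangeable: composing `f` with a
transposition of two of them does not change the weight. Hence no adaptive strategy beats naming a
fresh key `y` in advance (`sum_mul_hitProb_le`). Summing over `σ` again, `f y` is for each fixed `f`
a fixed key outside the renamed list, so it is positive with probability at most `ε`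
(`uniform_permGame_le`). A fresh `y` exists for large `l` because `n` is polynomial and there are `2
^ l` keys.

The step from `F_κ` to `f` is a reduction: a polynomial-size circuit with an oracle for the
permutation plays the whole game, logging the adversary's queries to decide the winner (`simulable`,
`exists_distinguisher`). Most of the work is building this circuit and bounding its size. Finally,
one negligible function must serve all adversaries, while pseudorandomness gives one for each
distinguisher family; a diagonal choice of exponents fixes this (`exists_negligible_advantage`). -/

theorem uniformOfFintype_bind_map_equiv {A B C : Type*} [Fintype A] [Nonempty A] [Fintype B]
    [Nonempty B] [Fintype C] [Nonempty C] (e : A × B ≃ C) :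
    ((PMF.uniformOfFintype A).bind fun a => (PMF.uniformOfFintype B).map fun b => e (a, b)) =
      PMF.uniformOfFintype C := by
  classical
  ext c
  obtain ⟨⟨a, b⟩, rfl⟩ := e.surjective c
  have hcard : Fintype.card C = Fintype.card A * Fintype.card B := by
    rw [← Fintype.card_congr e, Fintype.card_prod]
  rw [PMF.bind_apply, tsum_eq_single a]
  · rw [PMF.map_apply, tsum_eq_single b]
    · simp only [if_true, PMF.uniformOfFintype_apply, hcard, Nat.cast_mul]
      rw [ENNReal.mul_inv (Or.inr (ENNReal.natCast_ne_top _)) (Or.inl (ENNReal.natCast_ne_top _))]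
    · intro b' hb'
      rw [if_neg]
      simpa using hb'.symm
  · intro a' ha'
    rw [PMF.map_apply, mul_eq_zero]
    right
    rw [ENNReal.tsum_eq_zero]
    intro b'
    rw [if_neg]
    simp [ha'.symm]

/-! ### Output distributions of circuits -/

namespace Circuit

variable {S : OracleSig} {α β γ δ : Type}

theorem dist_wire (O : S.Answers) (f : β → α) (x : α → Bool) :
    (wire f : Circuit S α β).dist O x = PMF.pure (x ∘ f) := by
  simp [dist, run, PMF.pure_map]

theorem dist_seq (O : S.Answers) (c : Circuit S α β) (d : Circuit S β γ) (x : α → Bool) :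
    (c.seq d).dist O x = (c.dist O x).bind fun y => d.dist O y := by
  simp only [dist, run, PMF.map_bind, PMF.pure_map, PMF.bind_map]
  rfl

theorem dist_par (O : S.Answers) (c : Circuit S α β) (d : Circuit S γ δ) (x : α ⊕ γ → Bool) :
    (c.par d).dist O x = (c.dist O (x ∘ Sum.inl)).bind fun y =>
      (d.dist O (x ∘ Sum.inr)).map fun z => Sum.elim y z := by
  simp only [dist, run, PMF.map_bind, PMF.pure_map, PMF.bind_map, PMF.map_comp]
  rfl

theorem dist_oracle (O : S.Answers) (o : S.Op) (x : S.dom o → Bool) :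
    (oracle o : Circuit S _ _).dist O x = PMF.pure (O o x) := by
  simp [dist, run, PMF.pure_map]

/-- A circuit without oracle gates, as a circuit with oracles. -/
def lift (S : OracleSig) : {α β : Type} → Circuit noOracle α β → Circuit S α β
  | _, _, wire f => wire f
  | _, _, const b => const b
  | _, _, nand => nand
  | _, _, coin => coin
  | _, _, oracle o => Empty.elim o
  | _, _, seq c d => seq (c.lift S) (d.lift S)
  | _, _, par c d => par (c.lift S) (d.lift S)

theorem size_lift (c : Circuit noOracle α β) : (c.lift S).size = c.size := by
  induction c with
  | wire f => rfl
  | const b => rfl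
  | nand => rfl
  | coin => rfl
  | oracle o => exact Empty.elim o
  | seq c d hc hd => simp only [lift, size, hc, hd]
  | par c d hc hd => simp only [lift, size, hc, hd]

theorem dist_lift (O : S.Answers) (c : Circuit noOracle α β) (x : α → Bool) :
    (c.lift S).dist O x = c.out x := by
  induction c with
  | wire f => exact (dist_wire _ _ _).trans (dist_wire _ _ _).symm
  | const b => simp [out, lift, dist, run, PMF.pure_map]
  | nand => simp [out, lift, dist, run, PMF.pure_map]
  | coin => simp only [out, lift, dist, run, PMF.map_bind, PMF.pure_map]
  | oracle o => exact Empty.elim o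
  | seq c d hc hd =>
    rw [lift, dist_seq]
    simp only [hc, hd]
    exact (dist_seq _ c d x).symm
  | par c d hc hd =>
    rw [lift, dist_par]
    simp only [hc, hd]
    exact (dist_par _ c d x).symm

end Circuit

/-! ### Randomized functions computed by small circuits -/

/-- Some circuit of size at most `s` computes the randomized function `g a`, given oracles `O a`,
for all `a`. -/
def Impl {S : OracleSig} {ι : Type*} (O : ι → S.Answers) {α β : Type} (s : ℕ)
    (g : ι → (α → Bool) → PMF (β → Bool)) : Prop :=
  ∃ c : Circuit S α β, c.size ≤ s ∧ ∀ a x, c.dist (O a) x = g a x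

/-- Some circuit of size at most `s` computes the Boolean function `f a`, given oracles `O a`,
for all `a`. -/
def ImplBit {S : OracleSig} {ι : Type*} (O : ι → S.Answers) {α : Type} (s : ℕ)
    (f : ι → (α → Bool) → Bool) : Prop :=
  Impl O s fun a x => PMF.pure fun _ : Unit => f a x

namespace Impl

variable {S : OracleSig} {ι : Type*} {O : ι → S.Answers} {α β γ δ : Type} {s s' : ℕ}
  {g : ι → (α → Bool) → PMF (β → Bool)}

theorem congr {g' : ι → (α → Bool) → PMF (β → Bool)} (h : Impl O s g)
    (he : ∀ a x, g a x = g' a x) : Impl O s g' := by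
  obtain ⟨c, hc, h⟩ := h
  exact ⟨c, hc, fun a x => (h a x).trans (he a x)⟩

theorem mono (h : Impl O s g) (hs : s ≤ s') : Impl O s' g := by
  obtain ⟨c, hc, h⟩ := h
  exact ⟨c, hc.trans hs, h⟩

theorem wire (f : β → α) : Impl O 0 fun _ (x : α → Bool) => PMF.pure (x ∘ f) :=
  ⟨.wire f, le_rfl, fun _ _ => Circuit.dist_wire _ _ _⟩

theorem ofCircuit (c : Circuit noOracle α β) : Impl O c.size fun _ x => c.out x :=
  ⟨c.lift S, (Circuit.size_lift c).le, fun _ _ => Circuit.dist_lift _ _ _⟩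

theorem oracle (o : S.Op) : Impl O 1 fun a x => PMF.pure (O a o x) :=
  ⟨.oracle o, le_rfl, fun _ _ => Circuit.dist_oracle _ _ _⟩

theorem seq {h : ι → (β → Bool) → PMF (γ → Bool)} (hg : Impl O s g) (hh : Impl O s' h) :
    Impl O (s + s') fun a x => (g a x).bind fun y => h a y := by
  obtain ⟨c, hc, hg⟩ := hg
  obtain ⟨d, hd, hh⟩ := hh
  refine ⟨c.seq d, Nat.add_le_add hc hd, fun a x => ?_⟩
  simp only [Circuit.dist_seq, hg, hh]

theorem par {h : ι → (γ → Bool) → PMF (δ → Bool)} (hg : Impl O s g) (hh : Impl O s' h) :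
    Impl O (s + s') fun a (x : α ⊕ γ → Bool) => (g a (x ∘ Sum.inl)).bind fun y =>
      (h a (x ∘ Sum.inr)).map fun z => Sum.elim y z := by
  obtain ⟨c, hc, hg⟩ := hg
  obtain ⟨d, hd, hh⟩ := hh
  refine ⟨c.par d, Nat.add_le_add hc hd, fun a x => ?_⟩
  simp only [Circuit.dist_par, hg, hh]

theorem comap (h : Impl O s g) (f : α → γ) : Impl O s fun a (x : γ → Bool) => g a (x ∘ f) := by
  simpa using (Impl.wire (O := O) f).seq h

theorem map (h : Impl O s g) (f : γ → β) :
    Impl O s fun a x => (g a x).map fun y => y ∘ f :=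
  h.seq (Impl.wire f)

theorem pair {h : ι → (α → Bool) → PMF (γ → Bool)} (hg : Impl O s g) (hh : Impl O s' h) :
    Impl O (s + s') fun a x => (g a x).bind fun y => (h a x).map fun z => Sum.elim y z :=
  ((hg.par hh).comap (Sum.elim id id)).congr fun _ _ => rfl

/-- The input wires are copied past the first stage at no cost, so later stages of the simulated
game can still read the list and the state. -/
theorem bind {h : ι → (α ⊕ β → Bool) → PMF (γ → Bool)} (hg : Impl O s g) (hh : Impl O s' h) :
    Impl O (s + s') fun a x => (g a x).bind fun y => h a (Sum.elim x y) := by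
  have := ((Impl.wire (O := O) (id : α → α)).pair hg).seq hh
  rw [Nat.zero_add] at this
  refine this.congr fun a x => ?_
  simp only [PMF.pure_bind, PMF.bind_map]
  rfl

theorem coins (n : ℕ) :
    Impl O n fun _ (_ : Empty → Bool) => PMF.uniformOfFintype (Fin n → Bool) := by
  induction n with
  | zero =>
    refine (Impl.wire (O := O) (Fin.elim0 : Fin 0 → Empty)).congr fun _ x => ?_
    ext y
    rw [Subsingleton.elim y (x ∘ (Fin.elim0 : Fin 0 → Empty))]
    simp [PMF.uniformOfFintype_apply]
  | succ n ih =>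
    have hc : Impl O 1 fun _ (_ : Empty → Bool) =>
        (PMF.uniformOfFintype Bool).map fun b (_ : Unit) => b := by
      refine ⟨.coin, le_rfl, fun a x => ?_⟩
      simp only [Circuit.dist, Circuit.run, PMF.map_bind, PMF.pure_map]
      rfl
    have := (hc.pair ih).map (fun i : Fin (n + 1) =>
      (Fin.cons (Sum.inl ()) Sum.inr : Fin (n + 1) → Unit ⊕ Fin n) i)
    refine (this.congr fun a x => ?_).mono (Nat.add_comm 1 n).le
    -- A uniform string of `n + 1` bits is a uniform first bit followed by an independent uniform
    -- string of `n` bits.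
    rw [← uniformOfFintype_bind_map_equiv (Fin.consEquiv fun _ : Fin (n + 1) => Bool)]
    simp only [PMF.map_bind, PMF.bind_map]
    refine congrArg _ (funext fun b => ?_)
    rw [Function.comp_apply, PMF.map_comp]
    refine congrArg (fun f => PMF.map f _) (funext fun y => ?_)
    ext i
    refine Fin.cases ?_ (fun j => ?_) i <;> simp

end Impl

namespace ImplBit

variable {S : OracleSig} {ι : Type*} {O : ι → S.Answers} {α β γ : Type} {s s' : ℕ}
  {f f' : ι → (α → Bool) → Bool}

theorem congr (h : ImplBit O s f) (he : ∀ a x, f a x = f' a x) : ImplBit O s f' :=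
  Impl.congr h fun a x => by rw [he]

theorem mono (h : ImplBit O s f) (hs : s ≤ s') : ImplBit O s' f :=
  Impl.mono h hs

theorem comap (h : ImplBit O s f) (w : α → γ) : ImplBit O s fun a (x : γ → Bool) => f a (x ∘ w) :=
  Impl.comap h w

theorem var (i : α) : ImplBit O 0 fun _ x => x i :=
  Impl.wire fun _ => i

theorem const (b : Bool) : ImplBit O 1 fun _ (_ : α → Bool) => b := by
  have h : ImplBit O 1 fun _ (_ : Empty → Bool) => b :=
    ⟨.const b, le_rfl, fun a x => by simp [Circuit.dist, Circuit.run, PMF.pure_map]⟩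
  exact h.comap Empty.elim

theorem nand (h : ImplBit O s f) (h' : ImplBit O s' f') :
    ImplBit O (s + s' + 1) fun a x => !(f a x && f' a x) := by
  have hn : Impl O 1 fun _ (x : Unit ⊕ Unit → Bool) =>
      PMF.pure fun _ : Unit => !(x (Sum.inl ()) && x (Sum.inr ())) :=
    ⟨.nand, le_rfl, fun a x => by simp [Circuit.dist, Circuit.run, PMF.pure_map]⟩
  refine ((Impl.pair h h').seq hn).congr fun a x => ?_
  simp [PMF.pure_bind, PMF.pure_map]

theorem not (h : ImplBit O s f) : ImplBit O (s + 2) fun a x => !f a x :=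
  -- Two gates: the constant and the NAND. The constants 3, 5 and 15 below all come from this cost.
  ((h.nand (const true)).congr fun a x => by simp).mono (by omega)

theorem and (h : ImplBit O s f) (h' : ImplBit O s' f') :
    ImplBit O (s + s' + 3) fun a x => f a x && f' a x :=
  ((h.nand h').not.congr fun a x => by simp).mono (by omega)

theorem or (h : ImplBit O s f) (h' : ImplBit O s' f') :
    ImplBit O (s + s' + 5) fun a x => f a x || f' a x :=
  ((h.not.nand h'.not).congr fun a x => by simp).mono (by omega)

theorem beq (h : ImplBit O s f) (h' : ImplBit O s' f') :
    ImplBit O (2 * s + 2 * s' + 15) fun a x => f a x == f' a x :=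
  (((h.and h').or (h.not.and h'.not)).congr fun a x => by
    cases f a x <;> cases f' a x <;> rfl).mono (by omega)

theorem any_fin {n : ℕ} {f : Fin n → ι → (α → Bool) → Bool} (h : ∀ j, ImplBit O s (f j)) :
    ImplBit O (n * (s + 5) + 1) fun a x => decide (∃ j, f j a x = true) := by
  induction n with
  | zero => exact ((const false).congr fun a x => by simp).mono (by omega)
  | succ n ih =>
    refine (((h 0).or (ih fun j => h j.succ)).congr fun a x => ?_).mono (by ring_nf; omega)
    simp [Fin.exists_fin_succ]

theorem any {J : Type*} [Fintype J] {f : J → ι → (α → Bool) → Bool}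
    (h : ∀ j, ImplBit O s (f j)) :
    ImplBit O (Fintype.card J * (s + 5) + 1) fun a x => decide (∃ j, f j a x = true) :=
  (any_fin fun j => h ((Fintype.equivFin J).symm j)).congr fun a x => by
    simp [(Fintype.equivFin J).symm.exists_congr_left]

theorem all {J : Type*} [Fintype J] {f : J → ι → (α → Bool) → Bool}
    (h : ∀ j, ImplBit O s (f j)) :
    ImplBit O (Fintype.card J * (s + 7) + 3) fun a x => decide (∀ j, f j a x = true) :=
  ((any fun j => (h j).not).not.congr fun a x => by
    rw [← decide_not]
    simp).mono (by rw [show s + 2 + 5 = s + 7 by omega])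

/-- Equality of two strings of wires. -/
theorem eq {J : Type} [Fintype J] [DecidableEq (J → Bool)] (u v : J → α) :
    ImplBit O (Fintype.card J * 22 + 3) fun _ x => decide (x ∘ u = x ∘ v) :=
  ((all fun j => (var (O := O) (u j)).beq (var (v j))).congr fun a x => by
    simp [funext_iff]).mono (by omega)

theorem tuple_fin {n : ℕ} {f : Fin n → ι → (α → Bool) → Bool} (h : ∀ j, ImplBit O s (f j)) :
    Impl O (n * s) fun a x => PMF.pure fun j => f j a x := by
  induction n with
  | zero =>
    refine ((Impl.wire (Fin.elim0 : Fin 0 → α)).congr fun a x => ?_).mono (by omega)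
    exact congrArg _ (Subsingleton.elim _ _)
  | succ n ih =>
    have := (Impl.pair (h 0) (ih fun j => h j.succ)).map (fun i : Fin (n + 1) =>
      (Fin.cons (Sum.inl ()) Sum.inr : Fin (n + 1) → Unit ⊕ Fin n) i)
    refine (this.congr fun a x => ?_).mono (by ring_nf; omega)
    simp only [PMF.pure_bind, PMF.pure_map]
    congr 1
    ext i
    refine Fin.cases ?_ (fun j => ?_) i <;> simp

/-- Computation of all bits of a string. -/
theorem tuple {J : Type} [Fintype J] {f : J → ι → (α → Bool) → Bool}
    (h : ∀ j, ImplBit O s (f j)) :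
    Impl O (Fintype.card J * s) fun a x => PMF.pure fun j => f j a x :=
  ((tuple_fin fun j => h ((Fintype.equivFin J).symm j)).map (Fintype.equivFin J)).congr
    fun a x => by
      simp only [PMF.pure_map]
      congr 1
      ext j
      simp

end ImplBit

/-! ### Polynomial bounds -/

namespace PolyBounded

variable {ι : Type*} {par f g : ι → ℕ}

theorem mono (hf : PolyBounded par f) (h : ∀ a, g a ≤ f a) : PolyBounded par g := by
  obtain ⟨p, hp⟩ := hf
  exact ⟨p, fun a => (h a).trans (hp a)⟩

theorem const (c : ℕ) : PolyBounded par fun _ => c :=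
  ⟨.C c, fun a => by simp⟩

theorem param : PolyBounded par par :=
  ⟨.X, fun a => by simp⟩

theorem add (hf : PolyBounded par f) (hg : PolyBounded par g) :
    PolyBounded par fun a => f a + g a := by
  obtain ⟨p, hp⟩ := hf
  obtain ⟨q, hq⟩ := hg
  exact ⟨p + q, fun a => by simpa using Nat.add_le_add (hp a) (hq a)⟩

theorem mul (hf : PolyBounded par f) (hg : PolyBounded par g) :
    PolyBounded par fun a => f a * g a := by
  obtain ⟨p, hp⟩ := hf
  obtain ⟨q, hq⟩ := hg
  exact ⟨p * q, fun a => by simpa using Nat.mul_le_mul (hp a) (hq a)⟩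

theorem eval_mono (p : Polynomial ℕ) : Monotone fun a => p.eval a := by
  intro a b hab
  simp only [Polynomial.eval_eq_sum_range]
  gcongr

/-- Change of the parameter. -/
theorem comp {κ : Type*} {par' : κ → ℕ} (hf : PolyBounded par f) (w : κ → ι)
    (hw : PolyBounded par' fun b => par (w b)) : PolyBounded par' fun b => f (w b) := by
  obtain ⟨p, hp⟩ := hf
  obtain ⟨q, hq⟩ := hw
  refine ⟨p.comp q, fun b => (hp _).trans ?_⟩
  simpa using eval_mono p (hq b)

end PolyBounded

/-- The base is at least 2 even at `n = 0`, so raising the exponent absorbs coefficients (`a ≤ 2 ^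
a`) and the factor 2 arising from a sum. Polynomial size is thereby indexed by a single natural
number. -/
theorem exists_eval_le_pow (p : Polynomial ℕ) : ∃ c, ∀ n, p.eval n ≤ (n + 2) ^ c := by
  induction p using Polynomial.induction_on' with
  | add p q hp hq =>
    obtain ⟨a, ha⟩ := hp
    obtain ⟨b, hb⟩ := hq
    refine ⟨max a b + 1, fun n => ?_⟩
    have h1 : (n + 2) ^ a ≤ (n + 2) ^ max a b := Nat.pow_le_pow_right (by omega) (le_max_left _ _)
    have h2 : (n + 2) ^ b ≤ (n + 2) ^ max a b := Nat.pow_le_pow_right (by omega) (le_max_right _ _)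
    have := ha n
    have := hb n
    rw [Polynomial.eval_add, pow_succ]
    nlinarith
  | monomial k a =>
    refine ⟨a + k, fun n => ?_⟩
    rw [Polynomial.eval_monomial, pow_add]
    refine Nat.mul_le_mul ?_ (Nat.pow_le_pow_left (by omega) k)
    exact a.lt_two_pow_self.le.trans (Nat.pow_le_pow_left (by omega) a)

theorem pmf_bind_apply_le {A B : Type*} (p : PMF A) (q : A → PMF B) (b : B) {r : ENNReal}
    (h : ∀ a, q a b ≤ r) : (p.bind q) b ≤ r := by
  rw [PMF.bind_apply]
  calc ∑' a, p a * q a b ≤ ∑' a, p a * r := ENNReal.tsum_le_tsum fun a => by gcongr; exact h a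
    _ = r := by rw [ENNReal.tsum_mul_right, PMF.tsum_coe, one_mul]

theorem le_ofReal_of_toReal_le {x : ENNReal} {r : ℝ} (hx : x ≠ ⊤) (h : x.toReal ≤ r) :
    x ≤ ENNReal.ofReal r := by
  rw [← ENNReal.ofReal_toReal hx]
  exact ENNReal.ofReal_le_ofReal h

/-! ### The store with permuted keys: correctness, filters, memory, efficiency. -/

namespace LSMScheme

/-- Application of `f` to all keys of a list. -/
def mapKeys {l i : ℕ} (f : Bits l → Bits l) (L : Fin i → Entry l) : Fin i → Entry l :=
  fun a => (f (L a).1, (L a).2)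

theorem lastValue_mapKeys {l i : ℕ} {f : Bits l → Bits l} (hf : Function.Injective f)
    (L : Fin i → Entry l) (x : Bits l) : lastValue (mapKeys f L) (f x) = lastValue L x := by
  induction i with
  | zero => rfl
  | succ i ih =>
    simp only [lastValue]
    rw [show (fun j : Fin i => mapKeys f L j.castSucc) = mapKeys f (fun j => L j.castSucc) from rfl,
      ih]
    simp [mapKeys, hf.eq_iff]

section Keys

variable {l s : ℕ} {β : Type}

@[simp] theorem baseState_addKey (κ : Bits l) (σ : Fin s ⊕ β → Bool) :
    baseState (addKey κ σ) = σ := by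
  ext (a | b) <;> simp [baseState, addKey]

@[simp] theorem addedKey_addKey (κ : Bits l) (σ : Fin s ⊕ β → Bool) :
    addedKey (addKey κ σ) = κ := by
  ext a
  simp [addedKey, addKey]

/-- The wires of a state with an added key. -/
def addKeyWire (l s : ℕ) (β : Type) : Fin (s + l) ⊕ β → (Fin s ⊕ β) ⊕ Fin l :=
  Sum.elim (fun a => Sum.elim (fun b => Sum.inl (Sum.inl b)) Sum.inr (finSumFinEquiv.symm a))
    fun b => Sum.inl (Sum.inr b)

theorem elim_comp_addKeyWire (κ : Bits l) (σ : Fin s ⊕ β → Bool) :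
    Sum.elim σ κ ∘ addKeyWire l s β = addKey κ σ := by
  ext (a | b)
  · simp only [addKeyWire, addKey, Function.comp_apply, Sum.elim_inl]
    refine Fin.addCases (fun i => ?_) (fun i => ?_) a <;> simp
  · simp [addKeyWire, addKey]

/-- The wires of a state without the added key. -/
def baseWire (l s : ℕ) (β : Type) : Fin s ⊕ β → Fin (s + l) ⊕ β :=
  Sum.map (Fin.castAdd l) id

end Keys

variable {Λ : LSMScheme} {F : KeyedPerm} {l i : ℕ}

/-- Each insertion reads the added key from the state and puts it back unchanged, so its draw can be
pulled out in front of all insertions. -/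
theorem load_withPerm (L : Fin i → Entry l) :
    (Λ.withPerm F).load l L = (PMF.uniformOfFintype (Bits l)).bind fun κ =>
      (Λ.load l (mapKeys (F l κ) L)).map (addKey κ) := by
  induction i with
  | zero => rfl
  | succ i ih =>
    simp only [load]
    rw [ih]
    simp only [PMF.bind_bind, PMF.map_bind, PMF.bind_map]
    refine congrArg _ (funext fun κ => ?_)
    refine congrArg _ (funext fun σ => ?_)
    simp [mapKeys]

theorem mem_support_load_withPerm {L : Fin i → Entry l} {σ : (Λ.withPerm F).State l i}
    (h : σ ∈ ((Λ.withPerm F).load l L).support) :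
    ∃ κ, ∃ σ' ∈ (Λ.load l (mapKeys (F l κ) L)).support, addKey κ σ' = σ := by
  rw [load_withPerm, PMF.mem_support_bind_iff] at h
  obtain ⟨κ, -, h⟩ := h
  rw [PMF.mem_support_map_iff] at h
  exact ⟨κ, h⟩

theorem filterAnswer_withPerm (κ : Bits l) (σ : Λ.State l i) (j : Fin (Λ.numFilters l i))
    (x : Bits l) :
    (Λ.withPerm F).filterAnswer (i := i) (addKey κ σ) j x = Λ.filterAnswer σ j (F l κ x) := by
  simp [filterAnswer, secret, filters, addKey]
  rfl

theorem anyFilter_withPerm (κ : Bits l) (σ : Λ.State l i) (x : Bits l) :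
    (Λ.withPerm F).anyFilter (i := i) (addKey κ σ) x = Λ.anyFilter σ (F l κ x) :=
  decide_eq_decide.2 (exists_congr fun j => by rw [filterAnswer_withPerm])

theorem correct_withPerm (h : Λ.Correct) : (Λ.withPerm F).Correct := by
  intro l i L σ hσ x
  obtain ⟨κ, σ, hσ', rfl⟩ := mem_support_load_withPerm hσ
  simp only [baseState_addKey, addedKey_addKey]
  rw [h l i _ σ hσ', lastValue_mapKeys (F l κ).injective]

theorem filtersComplete_withPerm (h : Λ.FiltersComplete) : (Λ.withPerm F).FiltersComplete := by
  intro l i L σ hσ x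
  obtain ⟨κ, σ, hσ', rfl⟩ := mem_support_load_withPerm hσ
  obtain ⟨h1, h2, h3, h4⟩ := h l i _ σ hσ' (F l κ x)
  rw [lastValue_mapKeys (F l κ).injective] at h3
  simp only [baseState_addKey, addedKey_addKey, Set.mem_ofPred_eq]
  refine ⟨fun hx => ?_, fun j hx => ?_, h3, fun j hx => ?_⟩
  · obtain ⟨a, ha⟩ := h1 hx
    exact ⟨a, (F l κ).injective ha⟩
  · obtain ⟨a, ha⟩ := h2 j hx
    exact ⟨a, (F l κ).injective ha⟩
  · rw [filterAnswer_withPerm]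
    exact h4 j hx

theorem falsePositiveRate_withPerm {n : ℕ → ℕ} {ε : ℕ → ℝ} (h : Λ.FalsePositiveRate n ε) :
    (Λ.withPerm F).FalsePositiveRate n ε := by
  filter_upwards [h] with l h L x hx
  have hκ : ∀ κ, (((Λ.load l (mapKeys (F l κ) L)).map fun σ =>
      Λ.anyFilter σ (F l κ x)) true).toReal ≤ ε l := fun κ =>
    h _ _ fun a ha => hx a ((F l κ).injective ha)
  -- The all-zero key is an arbitrary choice; it only serves to show `0 ≤ ε l`.
  refine ENNReal.toReal_le_of_le_ofReal (ENNReal.toReal_nonneg.trans (hκ fun _ => false)) ?_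
  rw [load_withPerm, PMF.map_bind]
  refine pmf_bind_apply_le _ _ _ fun κ => ?_
  rw [PMF.map_comp]
  refine le_trans (le_of_eq ?_) (le_ofReal_of_toReal_le (PMF.apply_ne_top _ _) (hκ κ))
  congr 2
  ext σ
  exact anyFilter_withPerm κ σ x

theorem filterMemory_withPerm (l i : ℕ) :
    (Λ.withPerm F).filterMemory l i = Λ.filterMemory l i + l := by
  simp only [filterMemory]
  omega

/-- The oracles of the empty signature. -/
def noAnswers : Unit → noOracle.Answers := fun _ e => Empty.elim e

theorem exists_family {I : Type*} {α β : I → Type}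
    {size : I → ℕ} {g : (a : I) → (α a → Bool) → PMF (β a → Bool)}
    (h : ∀ a, Impl noAnswers (size a) fun _ => g a) :
    ∃ c : (a : I) → Circuit noOracle (α a) (β a), (∀ a, (c a).size ≤ size a) ∧
      ∀ a x, (c a).out x = g a x := by
  choose c hc hg using h
  exact ⟨c, hc, fun a x => hg a () x⟩

theorem polyBounded_fst : PolyBounded (fun a : ℕ × ℕ => a.1 + a.2) fun a => a.1 :=
  PolyBounded.param.mono fun _ => Nat.le_add_right _ _

theorem efficient_withPerm (h : Λ.Efficient) (hF : F.Efficient) : (Λ.withPerm F).Efficient := by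
  obtain ⟨⟨cF, hcF, hF⟩, -⟩ := hF
  have hcF' : PolyBounded (fun a : ℕ × ℕ => a.1 + a.2) fun a => (cF a.1).size :=
    hcF.comp Prod.fst polyBounded_fst
  refine ⟨h.numFilters, ?_, ?_, ?_, ?_, ?_⟩
  · refine (h.state.add polyBounded_fst).mono fun a => ?_
    change Fintype.card (Fin (Λ.secretBits a.1 + a.1) ⊕ Λ.FilterIdx a.1 a.2 ⊕
      Fin (Λ.restBits a.1 a.2)) ≤ _
    simp only [Fintype.card_sum, Fintype.card_fin]
    omega
  · obtain ⟨c, hc, hΛ⟩ := h.construct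
    have key : ∀ l, Impl noAnswers (l + (c l).size) fun _ (_ : Empty → Bool) =>
        (Λ.withPerm F).construct l := fun l => by
      refine (((Impl.coins l).pair (Impl.ofCircuit (c l))).map
        -- The coins for `κ` come before the base state here, whereas `addKeyWire` expects the state
        -- on the left.
        fun a => (addKeyWire l _ _ a).swap).congr fun _ x => ?_
      rw [Subsingleton.elim x Empty.elim, hΛ, PMF.map_bind]
      refine congrArg _ (funext fun κ => ?_)
      rw [PMF.map_comp]
      refine congrArg (fun f => PMF.map f _) (funext fun σ => ?_)
      rw [← elim_comp_addKeyWire κ σ]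
      ext a
      simp only [Function.comp_apply]
      rcases addKeyWire l _ _ a with b | b <;> rfl
    obtain ⟨d, hd, hd'⟩ := exists_family key
    exact ⟨d, (PolyBounded.param.add hc).mono hd, fun l => hd' l _⟩
  · obtain ⟨c, hc, hΛ⟩ := h.insert
    have key : ∀ a : ℕ × ℕ, Impl noAnswers ((cF a.1).size + (c a.1 a.2).size)
        fun _ (x : (Fin a.1 ⊕ Option (Fin a.1)) ⊕ (Λ.withPerm F).StateIdx a.1 a.2 → Bool) =>
        ((cF a.1).out (Sum.elim (addedKey (x ∘ Sum.inr)) fun b => x (Sum.inl (Sum.inl b)))).bind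
          fun y => ((c a.1 a.2).out (Sum.elim (Sum.elim y fun b => x (Sum.inl (Sum.inr b)))
            (baseState (x ∘ Sum.inr)))).map (addKey (addedKey (x ∘ Sum.inr))) := fun ⟨l, i⟩ => by
      have h1 := (Impl.ofCircuit (O := noAnswers) (cF l)).comap
        (γ := (Fin l ⊕ Option (Fin l)) ⊕ (Λ.withPerm F).StateIdx l i)
        (Sum.elim (fun b => Sum.inr (Sum.inl (Fin.natAdd (Λ.secretBits l) b)))
          fun b => Sum.inl (Sum.inl b))
      have h2 := (Impl.ofCircuit (O := noAnswers) (c l i)).comap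
        (γ := ((Fin l ⊕ Option (Fin l)) ⊕ (Λ.withPerm F).StateIdx l i) ⊕ Fin l)
        (Sum.elim (Sum.elim Sum.inr fun b => Sum.inl (Sum.inl (Sum.inr b)))
          fun b => Sum.inl (Sum.inr (baseWire l _ _ b)))
      have h3 := (h2.pair (Impl.wire fun b : Fin l =>
        Sum.inl (Sum.inr (Sum.inl (Fin.natAdd (Λ.secretBits l) b))))).map (addKeyWire l _ _)
      refine (h1.bind h3).congr fun _ x => ?_
      congr 1
      · congr 1
        ext (b | b) <;> rfl
      · funext y
        rw [PMF.map_bind]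
        simp only [PMF.pure_map]
        rw [← PMF.bind_pure_comp]
        congr 1
        · congr 1
          ext ((b | b) | b | b) <;> rfl
        · funext σ
          rw [elim_comp_addKeyWire]
          rfl
    obtain ⟨d, hd, hd'⟩ := exists_family key
    refine ⟨fun l i => d (l, i), (hcF'.add hc).mono hd, fun l i e σ => ?_⟩
    rw [hd' (l, i)]
    refine (congrArg (fun p => PMF.bind p _) (hF l (addedKey σ) e.1)).trans ?_
    rw [PMF.pure_bind]
    exact congrArg (PMF.map _) (hΛ l i (F l (addedKey σ) e.1, e.2) (baseState σ))
  · obtain ⟨c, hc, hΛ⟩ := h.query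
    have key : ∀ a : ℕ × ℕ, Impl noAnswers ((cF a.1).size + (c a.1 a.2).size)
        fun _ (x : Fin a.1 ⊕ (Λ.withPerm F).StateIdx a.1 a.2 → Bool) =>
        ((cF a.1).out (Sum.elim (addedKey (x ∘ Sum.inr)) (x ∘ Sum.inl))).bind
          fun y => (c a.1 a.2).out (Sum.elim y (baseState (x ∘ Sum.inr))) := fun ⟨l, i⟩ => by
      have h1 := (Impl.ofCircuit (O := noAnswers) (cF l)).comap
        (γ := Fin l ⊕ (Λ.withPerm F).StateIdx l i)
        (Sum.elim (fun b => Sum.inr (Sum.inl (Fin.natAdd (Λ.secretBits l) b))) Sum.inl)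
      have h2 := (Impl.ofCircuit (O := noAnswers) (c l i)).comap
        (γ := (Fin l ⊕ (Λ.withPerm F).StateIdx l i) ⊕ Fin l)
        (Sum.elim Sum.inr fun b => Sum.inl (Sum.inr (baseWire l _ _ b)))
      refine (h1.bind h2).congr fun _ x => ?_
      congr 1
      · congr 1
        ext (b | b) <;> rfl
      · funext y
        congr 1
        ext (b | b | b) <;> rfl
    obtain ⟨d, hd, hd'⟩ := exists_family key
    refine ⟨fun l i => d (l, i), (hcF'.add hc).mono hd, fun l i x σ => ?_⟩
    rw [hd' (l, i)]
    refine (congrArg (fun p => PMF.bind p _) (hF l (addedKey σ) x)).trans ?_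
    rw [PMF.pure_bind]
    exact hΛ l i (F l (addedKey σ) x) (baseState σ)
  · obtain ⟨c, hc, hΛ⟩ := h.filterQuery
    have key : ∀ a : (l : ℕ) × (i : ℕ) × Fin (Λ.numFilters l i),
        Impl noAnswers ((cF a.1).size + (c a.1 a.2.1 a.2.2).size)
        fun _ (x : Fin a.1 ⊕ Fin (Λ.secretBits a.1 + a.1) ⊕
          Fin (Λ.filterBits a.1 a.2.1 a.2.2) → Bool) =>
        ((cF a.1).out (Sum.elim (fun b => x (Sum.inr (Sum.inl (Fin.natAdd (Λ.secretBits a.1) b))))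
          (x ∘ Sum.inl))).bind fun y => (c a.1 a.2.1 a.2.2).out (Sum.elim y
            (Sum.elim (fun b => x (Sum.inr (Sum.inl (Fin.castAdd a.1 b))))
              fun b => x (Sum.inr (Sum.inr b)))) := fun ⟨l, i, j⟩ => by
      have h1 := (Impl.ofCircuit (O := noAnswers) (cF l)).comap
        (γ := Fin l ⊕ Fin (Λ.secretBits l + l) ⊕ Fin (Λ.filterBits l i j))
        (Sum.elim (fun b => Sum.inr (Sum.inl (Fin.natAdd (Λ.secretBits l) b))) Sum.inl)
      have h2 := (Impl.ofCircuit (O := noAnswers) (c l i j)).comap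
        (γ := (Fin l ⊕ Fin (Λ.secretBits l + l) ⊕ Fin (Λ.filterBits l i j)) ⊕ Fin l)
        (Sum.elim Sum.inr (Sum.elim (fun b => Sum.inl (Sum.inr (Sum.inl (Fin.castAdd l b))))
          fun b => Sum.inl (Sum.inr (Sum.inr b))))
      refine (h1.bind h2).congr fun _ x => ?_
      congr 1
      · congr 1
        ext (b | b) <;> rfl
      · funext y
        congr 1
        ext (b | b | b) <;> rfl
    obtain ⟨d, hd, hd'⟩ := exists_family key
    refine ⟨fun l i j => d ⟨l, i, j⟩, ((hcF.comp (fun a : (l : ℕ) × (i : ℕ) ×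
      Fin (Λ.numFilters l i) => a.1) (PolyBounded.param.mono fun _ => Nat.le_add_right _ _)).add
        hc).mono hd, fun l i j x s b => ?_⟩
    rw [hd' ⟨l, i, j⟩]
    refine (congrArg (fun p => PMF.bind p _)
      (hF l (fun a => s (Fin.natAdd (Λ.secretBits l) a)) x)).trans ?_
    rw [PMF.pure_bind]
    exact hΛ l i j _ (fun a => s (Fin.castAdd l a)) b

theorem isLSMStore_withPerm (h : Λ.IsLSMStore) (hF : F.Efficient) : (Λ.withPerm F).IsLSMStore :=
  ⟨correct_withPerm h.correct, filtersComplete_withPerm h.filtersComplete,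
    efficient_withPerm h.efficient hF⟩

end LSMScheme

/-! ### Query trees -/

/-- Randomized algorithms with oracle queries and output in `B`, as decision trees. -/
inductive QueryTree (S : OracleSig) (B : Type) : Type
  | done (b : B) : QueryTree S B
  | coin (k : Bool → QueryTree S B) : QueryTree S B
  | ask (q : S.Query) (k : (S.cod q.1 → Bool) → QueryTree S B) : QueryTree S B

namespace QueryTree

variable {S : OracleSig} {B C : Type}

/-- The joint distribution of the output and of the list of oracle queries made. -/
noncomputable def eval (O : S.Answers) : QueryTree S B → PMF (B × List S.Query)
  | done b => PMF.pure (b, [])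
  | coin k => (PMF.uniformOfFintype Bool).bind fun b => (k b).eval O
  | ask q k => ((k (O q.1 q.2)).eval O).map fun r => (r.1, q :: r.2)

/-- Sequential composition. -/
def bind : QueryTree S B → (B → QueryTree S C) → QueryTree S C
  | done b, j => j b
  | coin k, j => coin fun b => (k b).bind j
  | ask q k, j => ask q fun a => (k a).bind j

theorem eval_bind (O : S.Answers) (t : QueryTree S B) (j : B → QueryTree S C) :
    (t.bind j).eval O = (t.eval O).bind fun y =>
      ((j y.1).eval O).map fun z => (z.1, y.2 ++ z.2) := by
  induction t with
  | done b =>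
    simp only [bind, eval, PMF.pure_bind, List.nil_append]
    exact ((j b).eval O).map_id.symm
  | coin k ih => simp only [bind, eval, ih, PMF.bind_bind]
  | ask q k ih =>
    simp only [bind, eval, ih, PMF.map_bind, PMF.bind_map, PMF.map_comp]
    rfl

end QueryTree

namespace Circuit

variable {S : OracleSig}

/-- The decision tree of a circuit. -/
def toTree : {α β : Type} → Circuit S α β → (α → Bool) → QueryTree S (β → Bool)
  | _, _, wire f, x => .done (x ∘ f)
  | _, _, const b, _ => .done fun _ => b
  | _, _, nand, x => .done fun _ => !(x (Sum.inl ()) && x (Sum.inr ()))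
  | _, _, coin, _ => .coin fun b => .done fun _ => b
  | _, _, oracle o, x => .ask ⟨o, x⟩ .done
  | _, _, seq c d, x => (c.toTree x).bind d.toTree
  | _, _, par c d, x => (c.toTree (x ∘ Sum.inl)).bind fun y =>
      (d.toTree (x ∘ Sum.inr)).bind fun z => .done (Sum.elim y z)

/-- In a circuit the continuation after an oracle gate is spread over the enclosing compositions.
The tree makes it explicit, which allows induction on the remaining strategy, one query at a time.
-/
theorem eval_toTree (O : S.Answers) {α β : Type} (c : Circuit S α β) (x : α → Bool) :
    (c.toTree x).eval O = c.run O x := by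
  induction c with
  | wire f => rfl
  | const b => rfl
  | nand => rfl
  | coin => rfl
  | oracle o => simp [toTree, QueryTree.eval, run, PMF.pure_map]
  | seq c d hc hd =>
    simp only [toTree, QueryTree.eval_bind, run, hc, hd]
    rfl
  | par c d hc hd =>
    simp only [toTree, QueryTree.eval_bind, QueryTree.eval, run, hc, hd, PMF.pure_map,
      PMF.map_bind, List.append_nil]

end Circuit

/-! ### The game with a permutation of the keys -/

namespace LSMScheme

variable {Λ : LSMScheme} {l i : ℕ}

/-- The oracles of the game for the state `σ`, if the permutation `f` is applied to all keys. -/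
def permutedAnswers (f : Equiv.Perm (Bits l)) (σ : Λ.State l i) : (Λ.smashSig l i).Answers
  | none => fun _ => Λ.filters σ
  | some _ => fun w _ => (decOpt (n := l) w).elim false fun x => Λ.anyFilter σ (f x)

open Classical in
/-- The probability that the output of a query tree is outside of `B`, not queried and positive. -/
noncomputable def hitProb (f : Equiv.Perm (Bits l)) (σ : Λ.State l i)
    (t : QueryTree (Λ.smashSig l i) (Bits l)) (B : Set (Bits l)) : ENNReal :=
  ((t.eval (permutedAnswers f σ)).map fun r =>
    decide (r.1 ∉ B ∧ r.1 ∉ r.2.filterMap Λ.askedKey ∧ Λ.anyFilter σ (f r.1) = true)) true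

/-- The indicator of positive keys. -/
def positive (σ : Λ.State l i) (x : Bits l) : ENNReal :=
  if Λ.anyFilter σ x = true then 1 else 0

variable {σ : Λ.State l i}

theorem hitProb_univ (f : Equiv.Perm (Bits l)) (t : QueryTree (Λ.smashSig l i) (Bits l)) :
    hitProb f σ t Set.univ = 0 := by
  simp [hitProb, PMF.map_apply]

theorem hitProb_done (f : Equiv.Perm (Bits l)) (k : Bits l) (B : Set (Bits l)) :
    hitProb f σ (.done k) B ≤ positive σ (f k) := by
  classical
  simp only [hitProb, positive, QueryTree.eval, PMF.pure_map, PMF.pure_apply]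
  split_ifs with h1 h2 <;> simp_all

theorem hitProb_done_of_mem (f : Equiv.Perm (Bits l)) {k : Bits l} {B : Set (Bits l)}
    (hk : k ∈ B) : hitProb f σ (.done k) B = 0 := by
  simp [hitProb, QueryTree.eval, PMF.pure_map, hk]

theorem hitProb_coin (f : Equiv.Perm (Bits l))
    (k : Bool → QueryTree (Λ.smashSig l i) (Bits l)) (B : Set (Bits l)) :
    hitProb f σ (.coin k) B = 2⁻¹ * hitProb f σ (k true) B + 2⁻¹ * hitProb f σ (k false) B := by
  simp only [hitProb, QueryTree.eval, PMF.map_bind]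
  rw [PMF.bind_apply, tsum_fintype, Fintype.sum_bool]
  simp [PMF.uniformOfFintype_apply]

theorem hitProb_ask_none (f : Equiv.Perm (Bits l)) {q : (Λ.smashSig l i).Query}
    (k : ((Λ.smashSig l i).cod q.1 → Bool) → QueryTree (Λ.smashSig l i) (Bits l))
    (B : Set (Bits l)) (hq : Λ.askedKey q = none) :
    hitProb f σ (.ask q k) B = hitProb f σ (k (permutedAnswers f σ q.1 q.2)) B := by
  simp only [hitProb, QueryTree.eval, PMF.map_comp, Function.comp_def]
  congr 2
  ext r
  congr 1
  simp [hq]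

/-- A queried key is forbidden as output, exactly like a key of the list; it moves from the
transcript into `B`, so the induction need not remember the transcript. -/
theorem hitProb_ask_some (f : Equiv.Perm (Bits l)) {q : (Λ.smashSig l i).Query}
    (k : ((Λ.smashSig l i).cod q.1 → Bool) → QueryTree (Λ.smashSig l i) (Bits l))
    (B : Set (Bits l)) {x : Bits l} (hq : Λ.askedKey q = some x) :
    hitProb f σ (.ask q k) B =
      hitProb f σ (k (permutedAnswers f σ q.1 q.2)) (Insert.insert x B) := by
  simp only [hitProb, QueryTree.eval, PMF.map_comp, Function.comp_def]
  congr 2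
  ext r
  congr 1
  simp [hq]
  tauto

/-- Reindexing by `f ↦ f ∘ swap x y` exchanges the two images and fixes the weight, since neither
key lies in `B`. -/
theorem sum_mul_positive_eq {B : Set (Bits l)} {h : Equiv.Perm (Bits l) → ENNReal}
    (hB : ∀ f f', (∀ x ∈ B, f x = f' x) → h f = h f') {x y : Bits l} (hx : x ∉ B) (hy : y ∉ B) :
    ∑ f, h f * positive σ (f x) = ∑ f, h f * positive σ (f y) := by
  rw [← Equiv.sum_comp (Equiv.mulRight (Equiv.swap x y))]
  refine Finset.sum_congr rfl fun f _ => ?_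
  congr 1
  · refine hB _ _ fun z hz => ?_
    simp only [Equiv.coe_mulRight, Equiv.Perm.mul_apply]
    rw [Equiv.swap_apply_of_ne_of_ne]
    · rintro rfl
      exact hx hz
    · rintro rfl
      exact hy hz
  · simp [Equiv.Perm.mul_apply]

/-- No strategy hits an unseen positive key with a larger probability than a fixed unseen key is
positive with. Here `B` is the set of keys whose images have been revealed. -/
theorem sum_mul_hitProb_le (t : QueryTree (Λ.smashSig l i) (Bits l)) :
    ∀ (B : Set (Bits l)) (h : Equiv.Perm (Bits l) → ENNReal),
      (∀ f f', (∀ x ∈ B, f x = f' x) → h f = h f') → ∀ y ∉ B,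
      ∑ f, h f * hitProb f σ t B ≤ ∑ f, h f * positive σ (f y) := by
  induction t with
  | done k =>
    intro B h hB y hy
    by_cases hk : k ∈ B
    · simp [hitProb_done_of_mem _ hk]
    · rw [sum_mul_positive_eq hB hy hk]
      gcongr
      exact hitProb_done _ _ _
  | coin k ih =>
    intro B h hB y hy
    have h2 : ∑ f, h f * hitProb f σ (.coin k) B =
        2⁻¹ * ∑ f, h f * hitProb f σ (k true) B + 2⁻¹ * ∑ f, h f * hitProb f σ (k false) B := by
      simp only [hitProb_coin, Finset.mul_sum, ← Finset.sum_add_distrib]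
      exact Finset.sum_congr rfl fun f _ => by ring
    calc _ ≤ 2⁻¹ * ∑ f, h f * positive σ (f y) + 2⁻¹ * ∑ f, h f * positive σ (f y) := by
          rw [h2]
          exact add_le_add (mul_le_mul_right (ih true B h hB y hy) _)
            (mul_le_mul_right (ih false B h hB y hy) _)
      _ = _ := by rw [← add_mul, ENNReal.inv_two_add_inv_two, one_mul]
  | ask q k ih =>
    intro B h hB y hy
    rcases hq : Λ.askedKey q with _ | x
    -- With `σ` fixed, the filter states and the answer to a query whose flag is off do not depend
    -- on `f`, so nothing is learned.
    · have hc : ∃ a, ∀ f, permutedAnswers f σ q.1 q.2 = a := by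
        obtain ⟨_ | _, w⟩ := q
        · exact ⟨_, fun f => rfl⟩
        · replace hq : decOpt (n := l) w = none := hq
          exact ⟨fun _ => false, fun f => by simp [permutedAnswers, hq]⟩
      obtain ⟨a, ha⟩ := hc
      simp only [hitProb_ask_none _ _ _ hq, ha]
      exact ih a B h hB y hy
    · have hc : ∃ a : Bool → ((Λ.smashSig l i).cod q.1 → Bool), ∀ f,
          permutedAnswers f σ q.1 q.2 = a (Λ.anyFilter σ (f x)) := by
        obtain ⟨_ | _, w⟩ := q
        · exact absurd hq (by simp [askedKey])
        · replace hq : decOpt (n := l) w = some x := hq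
          exact ⟨fun b _ => b, fun f => by simp [permutedAnswers, hq]⟩
      obtain ⟨a, ha⟩ := hc
      simp only [hitProb_ask_some _ _ _ hq, ha]
      -- If every key has been seen, no output can win. Otherwise a key `z` outside the enlarged set
      -- exists, and it replaces `y`, which may equal `x`.
      by_cases hu : Insert.insert x B = Set.univ
      · simp [hu, hitProb_univ]
      · obtain ⟨z, hz⟩ := (Set.ne_univ_iff_exists_notMem _).1 hu
        rw [sum_mul_positive_eq hB hy fun hzB => hz (Set.mem_insert_of_mem _ hzB)]
        -- Conditioning on the answer `b`: the restricted weight depends only on `f` on the enlarged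
        -- set, so the induction hypothesis applies in each branch. The two restricted weights add
        -- up to `h`.
        have key : ∀ b, ∑ f, (if Λ.anyFilter σ (f x) = b then h f else 0) *
            hitProb f σ (k (a b)) (Insert.insert x B) ≤
            ∑ f, (if Λ.anyFilter σ (f x) = b then h f else 0) * positive σ (f z) := fun b =>
          ih (a b) (Insert.insert x B) _ (fun f f' hf => by
            rw [hf x (Set.mem_insert _ _),
              hB f f' fun w hw => hf w (Set.mem_insert_of_mem _ hw)]) z hz
        have := add_le_add (key true) (key false)
        rw [← Finset.sum_add_distrib, ← Finset.sum_add_distrib] at this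
        refine (Finset.sum_congr rfl fun f _ => ?_).trans_le
          (this.trans_eq (Finset.sum_congr rfl fun f _ => ?_))
        · cases Λ.anyFilter σ (f x) <;> simp
        · cases Λ.anyFilter σ (f x) <;> simp

/-- The game for a fixed list, if the permutation `f` is applied to all keys and the number of
queries is not limited. -/
noncomputable def permGame (c : Circuit (Λ.smashSig l i) (ListIdx l i) (Fin l))
    (L : Fin i → Entry l) (f : Equiv.Perm (Bits l)) : PMF Bool :=
  (Λ.load l (mapKeys f L)).bind fun σ =>
    (c.run (permutedAnswers f σ) (encList L)).map fun r =>
      decide ((∀ a, (L a).1 ≠ r.1) ∧ r.1 ∉ r.2.filterMap Λ.askedKey ∧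
        Λ.anyFilter σ (f r.1) = true)

theorem permGame_apply (c : Circuit (Λ.smashSig l i) (ListIdx l i) (Fin l))
    (L : Fin i → Entry l) (f : Equiv.Perm (Bits l)) :
    permGame c L f true = ∑ σ, Λ.load l (mapKeys f L) σ *
      hitProb f σ (c.toTree (encList L)) {x | ∃ a, (L a).1 = x} := by
  rw [permGame, PMF.bind_apply, tsum_fintype]
  refine Finset.sum_congr rfl fun σ _ => ?_
  rw [hitProb, Circuit.eval_toTree]
  congr 3
  ext r
  congr 1
  simp

/-- In the game with a uniformly random permutation, the adversary wins at most with the false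
positive probability. -/
theorem uniform_permGame_le (c : Circuit (Λ.smashSig l i) (ListIdx l i) (Fin l))
    (L : Fin i → Entry l) {r : ENNReal}
    (hr : ∀ (L : Fin i → Entry l) (x : Bits l), (∀ a, (L a).1 ≠ x) →
      ((Λ.load l L).map fun σ => Λ.anyFilter σ x) true ≤ r)
    {y : Bits l} (hy : ∀ a, (L a).1 ≠ y) :
    ((PMF.uniformOfFintype (Equiv.Perm (Bits l))).bind (permGame c L)) true ≤ r := by
  have key : ∑ f, permGame c L f true ≤ ∑ f : Equiv.Perm (Bits l), r := by
    simp only [permGame_apply]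
    rw [Finset.sum_comm]
    calc _ ≤ ∑ σ, ∑ f : Equiv.Perm (Bits l),
          Λ.load l (mapKeys f L) σ * positive σ (f y) := by
          -- The weight is the probability of reaching `σ`; it sees `f` only through the keys of
          -- `L`.
          refine Finset.sum_le_sum fun σ _ => sum_mul_hitProb_le _ _ _ (fun f f' hf => ?_) y ?_
          · rw [show mapKeys f L = mapKeys f' L from
              funext fun a => Prod.ext (hf _ ⟨a, rfl⟩) rfl]
          · rintro ⟨a, ha⟩
            exact hy a ha
      _ ≤ ∑ f : Equiv.Perm (Bits l), r := by
          rw [Finset.sum_comm]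
          refine Finset.sum_le_sum fun f _ => ?_
          -- For a fixed `f`, both the renamed list and `f y` are fixed before the coins of the
          -- store are tossed, so the false positive bound applies.
          refine le_trans (le_of_eq ?_) (hr (mapKeys f L) (f y) fun a ha => hy a (f.injective ha))
          rw [PMF.map_apply, tsum_fintype]
          refine Finset.sum_congr rfl fun σ _ => ?_
          cases h : Λ.anyFilter σ (f y) <;> simp [positive, h]
  rw [PMF.bind_apply, tsum_fintype]
  simp only [PMF.uniformOfFintype_apply]
  rw [← Finset.mul_sum]
  calc _ ≤ (Fintype.card (Equiv.Perm (Bits l)) : ENNReal)⁻¹ *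
        ∑ f : Equiv.Perm (Bits l), r := by gcongr
    _ = r := by
        rw [Finset.sum_const, Finset.card_univ, nsmul_eq_mul, ← mul_assoc, ENNReal.inv_mul_cancel,
          one_mul]
        · exact_mod_cast Fintype.card_ne_zero
        · exact ENNReal.natCast_ne_top _

end LSMScheme

/-- Masking by the flag normalizes an optional value. This is needed because the circuits of the
store are specified only on proper encodings, while the adversary may leave arbitrary bits under a
flag that is off. -/
theorem encOpt_decOpt_apply {n : ℕ} (w : Option (Fin n) → Bool) (b : Option (Fin n)) :
    encOpt (decOpt w) b = (w none && w b) := by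
  unfold decOpt
  cases h : w none <;> cases b <;> simp [encOpt, h]

theorem decOpt_eq_some {n : ℕ} (w : Option (Fin n) → Bool) (k : Bits n) :
    decOpt w = some k ↔ w none = true ∧ w ∘ some = k := by
  unfold decOpt
  cases h : w none <;> simp [Function.comp_def]

namespace LSMScheme

variable {Λ : LSMScheme} {l i : ℕ}

/-! ### Simulation of the store with an oracle for the permutation of the keys -/

theorem impl_insert {s : ℕ}
    {c : Circuit noOracle ((Fin l ⊕ Option (Fin l)) ⊕ Λ.StateIdx l i) (Λ.StateIdx l (i + 1))}
    (hs : c.size ≤ s)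
    (hc : ∀ (e : Entry l) (σ : Λ.State l i),
      c.out (Sum.elim (Sum.elim e.1 (encOpt e.2)) σ) = Λ.insert l i e σ) :
    Impl (permAnswers (n := l)) (s + 3 * l + 4)
      fun f (x : (Fin l ⊕ Option (Fin l)) ⊕ Λ.StateIdx l i → Bool) =>
        Λ.insert l i (f fun b => x (Sum.inl (Sum.inl b)), decOpt fun b => x (Sum.inl (Sum.inr b)))
          fun b => x (Sum.inr b) := by
  have h1 := (Impl.oracle (O := permAnswers (n := l)) true).comap
    (γ := (Fin l ⊕ Option (Fin l)) ⊕ Λ.StateIdx l i) fun b => Sum.inl (Sum.inl b)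
  -- Masking `l + 1` wires costs `3 * (l + 1)` gates; with the oracle gate this gives `3 * l + 4`.
  have h2 := ImplBit.tuple fun b : Option (Fin l) =>
    (ImplBit.var (O := permAnswers (n := l))
      (Sum.inl (Sum.inr none) : (Fin l ⊕ Option (Fin l)) ⊕ Λ.StateIdx l i)).and
        (ImplBit.var (Sum.inl (Sum.inr b)))
  have h3 := ((h1.pair h2).pair (Impl.wire Sum.inr)).seq (Impl.ofCircuit c)
  refine (h3.congr fun f x => ?_).mono ?_
  · simp only [PMF.pure_bind, PMF.pure_map]
    rw [← hc]
    congr 1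
    ext ((b | b) | b)
    · rfl
    · exact (encOpt_decOpt_apply (fun b => x (Sum.inl (Sum.inr b))) b).symm
    · rfl
  · simp only [Fintype.card_option, Fintype.card_fin]
    omega

theorem impl_load {s : ℕ} {cC : Circuit noOracle Empty (Λ.StateIdx l 0)}
    (hC : cC.out Empty.elim = Λ.construct l)
    {cI : (i : ℕ) →
      Circuit noOracle ((Fin l ⊕ Option (Fin l)) ⊕ Λ.StateIdx l i) (Λ.StateIdx l (i + 1))}
    (hI : ∀ (i : ℕ) (e : Entry l) (σ : Λ.State l i),
      (cI i).out (Sum.elim (Sum.elim e.1 (encOpt e.2)) σ) = Λ.insert l i e σ)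
    (hs : ∀ j < i, (cI j).size ≤ s) :
    Impl (permAnswers (n := l)) (cC.size + i * (s + 3 * l + 4))
      fun f (x : ListIdx l i → Bool) => Λ.load l (mapKeys f (decList x)) := by
  induction i with
  | zero =>
    refine (((Impl.ofCircuit cC).comap Empty.elim).congr fun f x => ?_).mono (by omega)
    rw [load, ← hC]
    exact congrArg _ (Subsingleton.elim _ _)
  | succ i ih =>
    have h1 := (ih fun j hj => hs j (by omega)).comap
      (γ := ListIdx l (i + 1)) fun b => (b.1.castSucc, b.2)
    have h2 := (impl_insert (hs i (by omega)) (hI i)).comap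
      (γ := ListIdx l (i + 1) ⊕ Λ.StateIdx l i)
      (Sum.map (fun b => (Fin.last i, b)) id)
    exact ((h1.bind h2).congr fun f x => rfl).mono (by ring_nf; omega)

theorem impl_encList :
    Impl (permAnswers (n := l)) (i * (2 * l + 1) * 3)
      fun _ (x : ListIdx l i → Bool) => PMF.pure (encList (decList x)) := by
  have h1 := ImplBit.tuple (O := permAnswers (n := l))
    (f := fun (b : ListIdx l i) _ (x : ListIdx l i → Bool) => encList (decList x) b) (s := 3)
    fun b => by
      obtain ⟨a, b | b⟩ := b
      · exact (ImplBit.var (a, Sum.inl b)).mono (by omega)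
      · refine ((ImplBit.var (a, Sum.inr none)).and (ImplBit.var (a, Sum.inr b))).congr
          fun f x => ?_
        exact (encOpt_decOpt_apply (fun b => x (a, Sum.inr b)) b).symm
  refine h1.mono (le_of_eq ?_)
  simp only [Fintype.card_prod, Fintype.card_sum, Fintype.card_option, Fintype.card_fin]
  ring

theorem implBit_anyFilter {s : ℕ}
    {c : (j : Fin (Λ.numFilters l i)) →
      Circuit noOracle (Fin l ⊕ Fin (Λ.secretBits l) ⊕ Fin (Λ.filterBits l i j)) Unit}
    (hc : ∀ (j : Fin (Λ.numFilters l i)) (x : Bits l) (s : Bits (Λ.secretBits l))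
      (b : Bits (Λ.filterBits l i j)),
      (c j).out (Sum.elim x (Sum.elim s b)) = PMF.pure fun _ => Λ.filterQuery l i j x s b)
    (hs : ∀ j, (c j).size ≤ s) :
    ImplBit (permAnswers (n := l)) (Λ.numFilters l i * (s + 5) + 2)
      fun f (x : Λ.StateIdx l i ⊕ Fin l → Bool) =>
        Λ.anyFilter (fun b => x (Sum.inl b)) (f fun b => x (Sum.inr b)) := by
  have h1 := (Impl.oracle (O := permAnswers (n := l)) true).comap
    (γ := Λ.StateIdx l i ⊕ Fin l) Sum.inr
  have h2 : ∀ j, ImplBit (permAnswers (n := l)) s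
      fun _ (x : (Λ.StateIdx l i ⊕ Fin l) ⊕ Fin l → Bool) =>
        Λ.filterAnswer (fun b => x (Sum.inl (Sum.inl b))) j fun b => x (Sum.inr b) := fun j => by
    refine (((Impl.ofCircuit (c j)).mono (hs j)).comap (Sum.elim Sum.inr (Sum.elim
      (fun b => Sum.inl (Sum.inl (Sum.inl b)))
      fun b => Sum.inl (Sum.inl (Sum.inr (Sum.inl ⟨j, b⟩)))))).congr fun f x => ?_
    refine Eq.trans (congrArg _ ?_) (hc j _ _ _)
    ext (b | b | b) <;> rfl
  refine Impl.congr ((h1.bind (ImplBit.any_fin h2)).mono (by omega)) fun f x => ?_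
  rw [PMF.pure_bind]
  rfl

/-! ### Simulation of the adversary -/

/-- The keys in a log of queries. -/
def loggedKeys {Q : Type} (w : Q × Option (Fin l) → Bool) : Set (Bits l) :=
  {k | ∃ q, decOpt (fun b => w (q, b)) = some k}

/-- The set of keys that occur in a list of queries. -/
def askedKeys (q : List (Λ.smashSig l i).Query) : Set (Bits l) :=
  {k | k ∈ q.filterMap Λ.askedKey}

@[simp] theorem askedKeys_nil : askedKeys ([] : List (Λ.smashSig l i).Query) = ∅ := by
  ext k
  simp [askedKeys]

theorem askedKeys_append (q r : List (Λ.smashSig l i).Query) :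
    askedKeys (q ++ r) = askedKeys q ∪ askedKeys r := by
  ext k
  simp [askedKeys]

/-- The union of two logs. -/
def joinLog {Q R : Type} (v : Q × Option (Fin l) → Bool) (w : R × Option (Fin l) → Bool) :
    (Q ⊕ R) × Option (Fin l) → Bool :=
  fun p => Sum.elim (fun q => v (q, p.2)) (fun q => w (q, p.2)) p.1

theorem loggedKeys_joinLog {Q R : Type} (v : Q × Option (Fin l) → Bool)
    (w : R × Option (Fin l) → Bool) :
    loggedKeys (joinLog v w) = loggedKeys v ∪ loggedKeys w := by
  ext k
  simp [loggedKeys, joinLog]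

/-- The wires of the union of two logs. -/
def joinLogWire (Q R : Type) (l : ℕ) :
    (Q ⊕ R) × Option (Fin l) → (Q × Option (Fin l)) ⊕ (R × Option (Fin l)) :=
  fun p => Sum.elim (fun q => Sum.inl (q, p.2)) (fun q => Sum.inr (q, p.2)) p.1

/-- The output and the queried keys of the simulation of a circuit, with a log of its queries. -/
def logged {β Q : Type} (w : β ⊕ (Q × Option (Fin l)) → Bool) : (β → Bool) × Set (Bits l) :=
  (w ∘ Sum.inl, loggedKeys (w ∘ Sum.inr))

/-- The output and the queried keys of a run. -/
def observed {β : Type} (r : (β → Bool) × List (Λ.smashSig l i).Query) :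
    (β → Bool) × Set (Bits l) :=
  (r.1, askedKeys r.2)

/-- A simulation of size at most `s` of the circuit `c`, with oracle access to the permutation of
the keys and the state as an additional input, that logs at most `N` queries. -/
def Simulable {α β : Type} (c : Circuit (Λ.smashSig l i) α β) (N s : ℕ) : Prop :=
  ∃ (Q : Type) (_ : Fintype Q), Fintype.card Q ≤ N ∧
    ∃ g : Equiv.Perm (Bits l) → (Λ.StateIdx l i ⊕ α → Bool) →
        PMF (β ⊕ (Q × Option (Fin l)) → Bool),
      Impl (permAnswers (n := l)) s g ∧
      ∀ f (σ : Λ.State l i) x, (g f (Sum.elim σ x)).map logged =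
        (c.run (permutedAnswers f σ) x).map observed

theorem simulable_of_impl {α β : Type} {c : Circuit (Λ.smashSig l i) α β} {N s : ℕ}
    {g : Equiv.Perm (Bits l) → (Λ.StateIdx l i ⊕ α → Bool) → PMF (β → Bool)}
    (h : Impl (permAnswers (n := l)) s g)
    (hc : ∀ f (σ : Λ.State l i) x, (g f (Sum.elim σ x)).map (fun y => (y, ∅)) =
        (c.run (permutedAnswers f σ) x).map observed) : Simulable c N s := by
  refine ⟨Empty, inferInstance, by simp, _, h.map (Sum.elim id fun q => q.1.elim),
    fun f σ x => ?_⟩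
  rw [PMF.map_comp, ← hc]
  congr 1
  ext y
  · rfl
  · simp [logged, loggedKeys]

/-- The logs are placed side by side. Comparing only the output and the set of queried keys
suffices, because winning without a query limit depends on nothing else in the transcript. -/
theorem simulable_seq {α β γ : Type} {c : Circuit (Λ.smashSig l i) α β}
    {d : Circuit (Λ.smashSig l i) β γ} {N N' s s' : ℕ} (hc : Simulable c N s)
    (hd : Simulable d N' s') : Simulable (c.seq d) (N + N') (s + s') := by
  obtain ⟨Q, hQ, hQN, g, hg, hgc⟩ := hc
  obtain ⟨R, hR, hRN, g', hg', hgd⟩ := hd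
  refine ⟨Q ⊕ R, inferInstance, by rw [Fintype.card_sum]; omega,
    fun f z => (g f z).bind fun v => (g' f (Sum.elim (z ∘ Sum.inl) (v ∘ Sum.inl))).map fun w =>
      Sum.elim (w ∘ Sum.inl) (joinLog (v ∘ Sum.inr) (w ∘ Sum.inr)), ?_, fun f σ x => ?_⟩
  · have h1 := hg'.comap (γ := (Λ.StateIdx l i ⊕ α) ⊕ (β ⊕ (Q × Option (Fin l))))
      (Sum.map Sum.inl Sum.inl)
    have h2 := (h1.pair (Impl.wire fun b => Sum.inr (Sum.inr b))).map
      (Sum.elim (fun b : γ => Sum.inl (Sum.inl b)) fun b =>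
        Sum.elim (fun a => Sum.inr a) (fun a => Sum.inl (Sum.inr a)) (joinLogWire Q R l b))
    refine (hg.bind h2).congr fun f z => ?_
    congr 1
    funext v
    rw [PMF.map_bind, show Sum.elim z v ∘ Sum.map Sum.inl Sum.inl =
      Sum.elim (z ∘ Sum.inl) (v ∘ Sum.inl) by ext (b | b) <;> rfl]
    simp only [PMF.pure_map]
    rw [← PMF.bind_pure_comp]
    congr 1
    funext w
    refine congrArg _ (funext fun b => ?_)
    obtain b | ⟨b | b, b'⟩ := b <;> rfl
  · simp only [Sum.elim_comp_inl, PMF.map_bind, PMF.map_comp, Circuit.run, PMF.pure_map]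
    have h1 : ∀ v : β ⊕ (Q × Option (Fin l)) → Bool,
        (g' f (Sum.elim σ (v ∘ Sum.inl))).map (logged ∘ fun w =>
        Sum.elim (w ∘ Sum.inl) (joinLog (v ∘ Sum.inr) (w ∘ Sum.inr))) =
        ((d.run (permutedAnswers f σ) (logged v).1).map observed).map
          fun p => (p.1, (logged v).2 ∪ p.2) := fun v => by
      rw [logged, ← hgd, PMF.map_comp]
      congr 1
      ext w
      · rfl
      · simp [logged, loggedKeys_joinLog]
    simp only [h1]
    have h2 := congrArg (fun p => p.bind fun q : (β → Bool) × Set (Bits l) =>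
      ((d.run (permutedAnswers f σ) q.1).map observed).map fun p => (p.1, q.2 ∪ p.2)) (hgc f σ x)
    simp only [PMF.bind_map] at h2
    refine h2.trans ?_
    congr 1
    funext y
    rw [Function.comp_apply, PMF.map_comp, ← PMF.bind_pure_comp]
    congr 1
    funext z
    simp [observed, askedKeys_append]

theorem simulable_par {α β γ δ : Type} {c : Circuit (Λ.smashSig l i) α β}
    {d : Circuit (Λ.smashSig l i) γ δ} {N N' s s' : ℕ} (hc : Simulable c N s)
    (hd : Simulable d N' s') : Simulable (c.par d) (N + N') (s + s') := by
  obtain ⟨Q, hQ, hQN, g, hg, hgc⟩ := hc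
  obtain ⟨R, hR, hRN, g', hg', hgd⟩ := hd
  refine ⟨Q ⊕ R, inferInstance, by rw [Fintype.card_sum]; omega,
    fun f z => (g f (Sum.elim (z ∘ Sum.inl) (z ∘ Sum.inr ∘ Sum.inl))).bind fun v =>
      (g' f (Sum.elim (z ∘ Sum.inl) (z ∘ Sum.inr ∘ Sum.inr))).map fun w =>
        Sum.elim (Sum.elim (v ∘ Sum.inl) (w ∘ Sum.inl)) (joinLog (v ∘ Sum.inr) (w ∘ Sum.inr)),
    ?_, fun f σ x => ?_⟩
  · have h1 := hg.comap (γ := Λ.StateIdx l i ⊕ (α ⊕ γ)) (Sum.map id Sum.inl)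
    have h2 := hg'.comap (γ := Λ.StateIdx l i ⊕ (α ⊕ γ)) (Sum.map id Sum.inr)
    have h3 := (h1.pair h2).map
      (Sum.elim (Sum.map (fun b : β => Sum.inl b) fun b : δ => Sum.inl b) fun b =>
        Sum.map Sum.inr Sum.inr (joinLogWire Q R l b))
    refine h3.congr fun f z => ?_
    rw [PMF.map_bind, show z ∘ Sum.map id Sum.inl =
      Sum.elim (z ∘ Sum.inl) (z ∘ Sum.inr ∘ Sum.inl) by ext (b | b) <;> rfl,
      show z ∘ Sum.map id Sum.inr =
      Sum.elim (z ∘ Sum.inl) (z ∘ Sum.inr ∘ Sum.inr) by ext (b | b) <;> rfl]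
    congr 1
    funext v
    rw [PMF.map_comp]
    congr 1
    funext w b
    obtain (b | b) | ⟨b | b, b'⟩ := b <;> rfl
  · simp only [Sum.elim_comp_inl, PMF.map_bind, PMF.map_comp, Circuit.run, PMF.pure_map]
    rw [← Function.comp_assoc, ← Function.comp_assoc, Sum.elim_comp_inr]
    have h1 : ∀ v : β ⊕ (Q × Option (Fin l)) → Bool,
        (g' f (Sum.elim σ (x ∘ Sum.inr))).map (logged ∘ fun w =>
        Sum.elim (Sum.elim (v ∘ Sum.inl) (w ∘ Sum.inl))
          (joinLog (v ∘ Sum.inr) (w ∘ Sum.inr))) =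
        ((d.run (permutedAnswers f σ) (x ∘ Sum.inr)).map observed).map
          fun p => (Sum.elim (logged v).1 p.1, (logged v).2 ∪ p.2) := fun v => by
      rw [logged, ← hgd, PMF.map_comp]
      congr 1
      ext w
      · rfl
      · simp [logged, loggedKeys_joinLog]
    simp only [h1]
    have h2 := congrArg (fun p => p.bind fun q : (β → Bool) × Set (Bits l) =>
      ((d.run (permutedAnswers f σ) (x ∘ Sum.inr)).map observed).map
        fun p => (Sum.elim q.1 p.1, q.2 ∪ p.2)) (hgc f σ (x ∘ Sum.inl))
    simp only [PMF.bind_map] at h2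
    refine h2.trans ?_
    congr 1
    funext y
    rw [Function.comp_apply, PMF.map_comp, ← PMF.bind_pure_comp]
    congr 1
    funext z
    simp [observed, askedKeys_append]

theorem simulable {s : ℕ}
    (hany : ImplBit (permAnswers (n := l)) s fun f (x : Λ.StateIdx l i ⊕ Fin l → Bool) =>
        Λ.anyFilter (fun b => x (Sum.inl b)) (f fun b => x (Sum.inr b)))
    {α β : Type} (c : Circuit (Λ.smashSig l i) α β) :
    Simulable c c.size (c.size * (s + 3)) := by
  induction c with
  | wire w =>
    refine simulable_of_impl ((Impl.wire (Sum.inr ∘ w)).mono (Nat.zero_le _)) fun f σ x => ?_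
    simp only [Circuit.run, PMF.pure_map, observed, askedKeys_nil]
    rfl
  | const b =>
    refine simulable_of_impl (((Impl.ofCircuit (.const b)).comap Sum.inr).mono
      (by simp only [Circuit.size]; omega)) fun f σ x => ?_
    simp [Circuit.out, Circuit.dist, Circuit.run, PMF.pure_map, observed]
  | nand =>
    refine simulable_of_impl (((Impl.ofCircuit .nand).comap Sum.inr).mono
      (by simp only [Circuit.size]; omega)) fun f σ x => ?_
    simp [Circuit.out, Circuit.dist, Circuit.run, PMF.pure_map, observed]
  | coin =>
    refine simulable_of_impl (((Impl.ofCircuit .coin).comap Sum.inr).mono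
      (by simp only [Circuit.size]; omega)) fun f σ x => ?_
    simp [Circuit.out, Circuit.dist, Circuit.run, PMF.map_bind, PMF.pure_map, observed]
  | oracle o =>
    obtain _ | u := o
    · refine simulable_of_impl (g := fun _ z => PMF.pure fun b => z (Sum.inl (Sum.inr (Sum.inl b))))
        ((Impl.wire _).mono (Nat.zero_le _)) fun f σ x => ?_
      simp only [Circuit.run, PMF.pure_map]
      congr 1
      ext k
      · rfl
      · simp [observed, askedKeys, askedKey]
    · have h1 := hany.comap (γ := Λ.StateIdx l i ⊕ Option (Fin l)) (Sum.map id some)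
      have h2 := (ImplBit.var (Sum.inr none)).and h1
      -- The raw query wires serve as the one log slot, flag included; masking the answer by the
      -- flag accounts for the 3 in `s + 3`.
      have h3 := Impl.pair h2 (Impl.wire fun b : Unit × Option (Fin l) => Sum.inr b.2)
      refine ⟨Unit, inferInstance, le_rfl, _, h3.mono ?_, fun f σ x => ?_⟩
      · simp only [Circuit.size]
        omega
      · simp only [PMF.pure_bind, Circuit.run, PMF.pure_map]
        refine (PMF.pure_map _ _).trans (congrArg PMF.pure (Prod.ext ?_ ?_))
        · funext b
          simp only [logged, observed, permutedAnswers, decOpt]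
          change (x none && _) = _
          cases h : x none
          · simp
          · simp
            rfl
        · ext k
          simp only [logged, observed, loggedKeys, askedKeys, Set.mem_ofPred_eq]
          simp [askedKey]
          change (∃ _ : Unit, decOpt (n := l) x = some k) ↔ decOpt (n := l) x = some k
          exact exists_const Unit
  | seq c d hc hd =>
    rw [Circuit.size, add_mul]
    exact simulable_seq hc hd
  | par c d hc hd =>
    rw [Circuit.size, add_mul]
    exact simulable_par hc hd

/-! ### The distinguisher -/

/-- The distinguisher chooses the list, loads the store through the oracle, simulates the attack and
checks for a win. The size bound has one summand for each of these stages and one for normalizing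
the list. A single circuit works for every permutation, hence in both the real and the ideal
experiment. -/
theorem exists_distinguisher {sI sQ : ℕ} {cC : Circuit noOracle Empty (Λ.StateIdx l 0)}
    (hC : cC.out Empty.elim = Λ.construct l)
    {cI : (i : ℕ) →
      Circuit noOracle ((Fin l ⊕ Option (Fin l)) ⊕ Λ.StateIdx l i) (Λ.StateIdx l (i + 1))}
    (hI : ∀ (i : ℕ) (e : Entry l) (σ : Λ.State l i),
      (cI i).out (Sum.elim (Sum.elim e.1 (encOpt e.2)) σ) = Λ.insert l i e σ)
    (hsI : ∀ j < i, (cI j).size ≤ sI)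
    {cQ : (j : Fin (Λ.numFilters l i)) →
      Circuit noOracle (Fin l ⊕ Fin (Λ.secretBits l) ⊕ Fin (Λ.filterBits l i j)) Unit}
    (hQ : ∀ (j : Fin (Λ.numFilters l i)) (x : Bits l) (s : Bits (Λ.secretBits l))
      (b : Bits (Λ.filterBits l i j)),
      (cQ j).out (Sum.elim x (Sum.elim s b)) = PMF.pure fun _ => Λ.filterQuery l i j x s b)
    (hsQ : ∀ j, (cQ j).size ≤ sQ)
    (choose : Circuit noOracle Empty (ListIdx l i))
    (attack : Circuit (Λ.smashSig l i) (ListIdx l i) (Fin l)) :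
    ∃ D : Circuit (permSig l) Empty Unit,
      D.size ≤ choose.size + (cC.size + i * (sI + 3 * l + 4)) + i * (2 * l + 1) * 3 +
        attack.size * (Λ.numFilters l i * (sQ + 5) + 5) +
        (i * (22 * l + 12) + attack.size * (22 * l + 11) +
          Λ.numFilters l i * (sQ + 5) + 14) ∧
      ∀ f, D.dist (permAnswers f) Empty.elim =
        ((choose.out Empty.elim).bind fun w => permGame attack (decList w) f).map
          fun b _ => b := by
  classical
  have hany := implBit_anyFilter hQ hsQ
  obtain ⟨Q, hQf, hQN, g, hg, hgc⟩ := simulable hany attack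
  have hload := impl_load (i := i) hC hI hsI
  have hsim := ((Impl.wire (O := permAnswers (n := l)) (α := ListIdx l i ⊕ Λ.StateIdx l i)
    Sum.inr).pair (impl_encList.comap Sum.inl)).seq hg
  have hcheck : ImplBit (permAnswers (n := l))
      (i * (22 * l + 12) + attack.size * (22 * l + 11) + Λ.numFilters l i * (sQ + 5) + 14)
      fun f (z : (ListIdx l i ⊕ Λ.StateIdx l i) ⊕ (Fin l ⊕ (Q × Option (Fin l))) → Bool) =>
        decide ((∀ a, (decList (fun b => z (Sum.inl (Sum.inl b))) a).1 ≠
            fun b => z (Sum.inr (Sum.inl b))) ∧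
          (fun b => z (Sum.inr (Sum.inl b))) ∉ loggedKeys (fun b => z (Sum.inr (Sum.inr b))) ∧
          Λ.anyFilter (fun b => z (Sum.inl (Sum.inr b))) (f fun b => z (Sum.inr (Sum.inl b))) =
            true) := by
    have h1 := ImplBit.all fun a : Fin i => (ImplBit.eq (O := permAnswers (n := l))
      (fun b : Fin l => (Sum.inl (Sum.inl (a, Sum.inl b)) :
        (ListIdx l i ⊕ Λ.StateIdx l i) ⊕ (Fin l ⊕ (Q × Option (Fin l)))))
      fun b => Sum.inr (Sum.inl b)).not
    have h2 := (ImplBit.any fun q : Q => (ImplBit.var (O := permAnswers (n := l))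
      (Sum.inr (Sum.inr (q, none)) :
        (ListIdx l i ⊕ Λ.StateIdx l i) ⊕ (Fin l ⊕ (Q × Option (Fin l))))).and (ImplBit.eq
      (fun b : Fin l => Sum.inr (Sum.inr (q, some b))) fun b => Sum.inr (Sum.inl b))).not
    have h3 := hany.comap
      (γ := (ListIdx l i ⊕ Λ.StateIdx l i) ⊕ (Fin l ⊕ (Q × Option (Fin l))))
      (Sum.map Sum.inr Sum.inl)
    refine ((h1.and (h2.and h3)).congr fun f z => ?_).mono ?_
    · rw [Bool.eq_iff_iff]
      simp only [Bool.and_eq_true, decide_eq_true_eq, Bool.not_eq_true', decide_eq_false_iff_not]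
      refine and_congr (forall_congr' fun a => Iff.rfl) (and_congr (not_congr ?_) Iff.rfl)
      refine exists_congr fun q => ?_
      rw [decOpt_eq_some]
      rfl
    · simp only [Fintype.card_fin]
      have h4 := Nat.mul_le_mul_right (22 * l + 11) hQN
      have h5 : Fintype.card Q * (0 + (l * 22 + 3) + 3 + 5) = Fintype.card Q * (22 * l + 11) := by
        ring
      have h6 : i * (l * 22 + 3 + 2 + 7) = i * (22 * l + 12) := by ring
      rw [h5, h6]
      omega
  have hD := (Impl.ofCircuit choose).seq (hload.bind (hsim.bind hcheck))
  obtain ⟨D, hDs, hD⟩ := hD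
  refine ⟨D, hDs.trans (by rw [Nat.add_assoc (Λ.numFilters l i * (sQ + 5)) 2 3]; omega),
    fun f => ?_⟩
  rw [hD, PMF.map_bind]
  refine congrArg _ (funext fun w => ?_)
  rw [permGame, PMF.map_bind]
  refine congrArg _ (funext fun σ => ?_)
  simp only [PMF.pure_bind, PMF.pure_map]
  have h1 := congrArg (PMF.map fun p : Bits l × Set (Bits l) => fun _ : Unit =>
    decide ((∀ a, (decList w a).1 ≠ p.1) ∧ p.1 ∉ p.2 ∧ Λ.anyFilter σ (f p.1) = true))
    (hgc f σ (encList (decList w)))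
  rw [PMF.map_comp, PMF.map_comp] at h1
  rw [PMF.map_comp]
  refine Eq.trans ?_ (h1.trans ?_)
  · rw [← PMF.bind_pure_comp]
    rfl
  · congr 1
    ext r
    exact decide_eq_decide.2 Iff.rfl

end LSMScheme

theorem pmf_bind_apply_mono {A B : Type*} (p : PMF A) {q q' : A → PMF B} {b : B}
    (h : ∀ a, q a b ≤ q' a b) : (p.bind q) b ≤ (p.bind q') b := by
  rw [PMF.bind_apply, PMF.bind_apply]
  exact ENNReal.tsum_le_tsum fun a => by gcongr; exact h a

theorem pmf_map_injective_apply {A B : Type*} (p : PMF A) {f : A → B} (hf : Function.Injective f)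
    (a : A) : (p.map f) (f a) = p a := by
  classical
  rw [PMF.map_apply, tsum_eq_single a]
  · simp
  · intro b hb
    rw [if_neg fun h => hb (hf h).symm]

theorem pmf_pure_decide_mono {p q : Prop} [Decidable p] [Decidable q] (h : p → q) :
    PMF.pure (decide p) true ≤ PMF.pure (decide q) true := by
  by_cases hp : p
  · simp [hp, h hp]
  · simp [hp, PMF.pure_apply]

theorem eventually_lt_two_pow {n : ℕ → ℕ} (hn : PolyBounded id n) : ∀ᶠ l in atTop, n l < 2 ^ l := by
  obtain ⟨p, hp⟩ := hn
  obtain ⟨c, hc⟩ := exists_eval_le_pow p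
  have h1 := (tendsto_pow_const_div_const_pow_of_one_lt c (one_lt_two (α := ℝ))).comp
    (tendsto_add_atTop_nat 2)
  -- The limit concerns `(l + 2) ^ c / 2 ^ (l + 2)`; the bound `1 / 4` cancels the factor `2 ^ 2`
  -- from the shift.
  filter_upwards [h1.eventually_lt_const (show (0 : ℝ) < 1 / 4 by norm_num)] with l hl
  rw [Function.comp_apply, div_lt_iff₀ (by positivity), pow_add (2 : ℝ)] at hl
  have h2 : ((l + 2) ^ c : ℝ) < 2 ^ l := by
    push_cast at hl
    linarith
  exact ((hp l).trans (hc l)).trans_lt (by exact_mod_cast h2)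

/-! ### One negligible bound for all polynomial-size distinguishers. -/

namespace KeyedPerm

variable {F : KeyedPerm}

/-- Every circuit of size at most `(n + 2) ^ c` has advantage at most `1 / n ^ c`. -/
def AdvantageBound (F : KeyedPerm) (n c : ℕ) : Prop :=
  ∀ D : Circuit (permSig n) Empty Unit, D.size ≤ (n + 2) ^ c →
    realProb F D - idealProb D ≤ ((n : ℝ) ^ c)⁻¹

/-- Picking a violating circuit for each `n` at which the bound fails, and a trivial circuit
elsewhere, gives one family of polynomial size; its negligible advantage rules out violations for
large `n`. -/
theorem eventually_advantageBound (hF : F.IsPRP) (c : ℕ) :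
    ∀ᶠ n in atTop, F.AdvantageBound n c := by
  have h : ∀ n, ∃ D : Circuit (permSig n) Empty Unit, D.size ≤ (n + 2) ^ c ∧
      (realProb F D - idealProb D ≤ ((n : ℝ) ^ c)⁻¹ → F.AdvantageBound n c) := fun n => by
    by_cases hb : F.AdvantageBound n c
    · exact ⟨.const true, Nat.one_le_pow _ _ (by omega), fun _ => hb⟩
    · obtain ⟨D, hD⟩ := not_forall.1 hb
      obtain ⟨hD, hD'⟩ := Classical.not_imp.1 hD
      exact ⟨D, hD, fun h => absurd h hD'⟩
  choose D hD hb using h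
  have hpoly : PolyBounded id fun n => (D n).size :=
    ⟨(.X + .C 2) ^ c, fun n => by simpa using hD n⟩
  filter_upwards [hF.2 D hpoly c] with n hn
  exact hb n ((le_abs_self _).trans hn)

/-- A single negligible function bounds the advantages of all efficient distinguishers. -/
theorem exists_negligible_advantage (hF : F.IsPRP) :
    ∃ negl : ℕ → ℝ, Negligible negl ∧
      ∀ s : ℕ → ℕ, PolyBounded id s → ∀ᶠ n in atTop, ∀ D : Circuit (permSig n) Empty Unit,
        D.size ≤ s n → realProb F D - idealProb D ≤ negl n := by
  classical
  have hle : ∀ c, ∀ᶠ n in atTop, F.AdvantageBound n c ∧ c ≤ n ∧ 1 ≤ n := fun c =>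
    (eventually_advantageBound hF c).and ((eventually_ge_atTop c).and (eventually_ge_atTop 1))
  -- Diagonal choice: the exponent is the largest `c ≤ n` whose bound holds at `n`. It eventually
  -- exceeds every fixed `c`, so the function is negligible and the admitted size `(n + 2) ^ c`
  -- eventually covers every polynomial.
  refine ⟨fun n => ((n : ℝ) ^ Nat.findGreatest (F.AdvantageBound n) n)⁻¹, fun c => ?_,
    fun s hs => ?_⟩
  · filter_upwards [hle c] with n ⟨hn, hcn, h1⟩
    rw [abs_of_nonneg (by positivity)]
    have h1' : (1 : ℝ) ≤ n := by exact_mod_cast h1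
    have := pow_le_pow_right₀ h1' (Nat.le_findGreatest hcn hn)
    gcongr
  · obtain ⟨p, hp⟩ := hs
    obtain ⟨c, hc⟩ := exists_eval_le_pow p
    filter_upwards [hle c] with n ⟨hn, hcn, h1⟩ D hD
    refine Nat.findGreatest_spec hcn hn D ((hD.trans ((hp n).trans (hc n))).trans ?_)
    exact Nat.pow_le_pow_right (by omega) (Nat.le_findGreatest hcn hn)

end KeyedPerm

/-! ### The reduction from the game to pseudorandomness. -/

namespace LSMScheme

variable {Λ : LSMScheme} {F : KeyedPerm}

/-- The added key lies in the secret part of the state, so the adversary's view depends on `κ` only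
through evaluations of `F_κ`; this is what lets an oracle take its place. -/
theorem smashAnswers_withPerm {l i : ℕ} (κ : Bits l) (σ : Λ.State l i) :
    (Λ.withPerm F).smashAnswers (i := i) (addKey κ σ) = permutedAnswers (F l κ) σ := by
  funext o
  obtain _ | _ := o
  · rfl
  · funext w _
    change (decOpt (n := l) w).elim false _ = (decOpt (n := l) w).elim false _
    congr 1
    funext x
    exact anyFilter_withPerm κ σ x

theorem filterMap_askedKey_withPerm {l i : ℕ} (q : List (Λ.smashSig l i).Query) :
    List.filterMap (Λ.withPerm F).askedKey q = List.filterMap Λ.askedKey q :=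
  congrArg (fun g => List.filterMap g q) (funext fun ⟨o, _⟩ => by cases o <;> rfl)

theorem smash_withPerm_le {n : ℕ → ℕ} (A : (Λ.withPerm F).Adversary n) (t l : ℕ) :
    (Λ.withPerm F).smash A t l true ≤
      ((PMF.uniformOfFintype (Bits l)).bind fun κ => ((A.choose l).out Empty.elim).bind fun w =>
        permGame (Λ := Λ) (A.attack l) (decList w) (F l κ)) true := by
  -- The list is chosen independently of `κ`, so the two draws commute.
  rw [PMF.bind_comm, smash]
  refine pmf_bind_apply_mono _ fun w => ?_
  rw [load_withPerm, PMF.bind_bind]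
  refine pmf_bind_apply_mono _ fun κ => ?_
  rw [PMF.bind_map]
  unfold permGame
  refine pmf_bind_apply_mono _ fun σ => ?_
  rw [Function.comp_apply, smashAnswers_withPerm, ← PMF.bind_pure_comp]
  refine pmf_bind_apply_mono _ fun r => ?_
  rw [anyFilter_withPerm]
  exact pmf_pure_decide_mono fun h =>
    ⟨h.2.1, fun hr => h.2.2.1 ((filterMap_askedKey_withPerm (Λ := Λ) (F := F) r.2).symm ▸ hr), h.2.2.2⟩

theorem realProb_eq {l : ℕ} {D : Circuit (permSig l) Empty Unit}
    {G : Equiv.Perm (Bits l) → PMF Bool}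
    (h : ∀ f, D.dist (permAnswers f) Empty.elim = (G f).map fun b _ => b) :
    KeyedPerm.realProb F D =
      (((PMF.uniformOfFintype (Bits l)).bind fun κ => G (F l κ)) true).toReal := by
  simp only [KeyedPerm.realProb, h]
  rw [← PMF.map_bind, pmf_map_injective_apply (f := fun b (_ : Unit) => b) _ fun a b hab =>
    congrFun hab ()]

theorem idealProb_eq {l : ℕ} {D : Circuit (permSig l) Empty Unit}
    {G : Equiv.Perm (Bits l) → PMF Bool}
    (h : ∀ f, D.dist (permAnswers f) Empty.elim = (G f).map fun b _ => b) :
    KeyedPerm.idealProb D =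
      (((PMF.uniformOfFintype (Equiv.Perm (Bits l))).bind G) true).toReal := by
  simp only [KeyedPerm.idealProb, h]
  rw [← PMF.map_bind, pmf_map_injective_apply (f := fun b (_ : Unit) => b) _ fun a b hab =>
    congrFun hab ()]

/-- The adversaries against the store with permuted keys yield efficient distinguishers. -/
theorem exists_efficient_distinguishers (hΛ : Λ.Efficient) {n : ℕ → ℕ} (hn : PolyBounded id n)
    {A : (Λ.withPerm F).Adversary n} (hA : A.Efficient) :
    ∃ s : ℕ → ℕ, PolyBounded id s ∧ ∀ l, ∃ D : Circuit (permSig l) Empty Unit, D.size ≤ s l ∧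
      ∀ f, D.dist (permAnswers f) Empty.elim =
        (((A.choose l).out Empty.elim).bind fun w =>
          permGame (Λ := Λ) (A.attack l) (decList w) f).map fun b _ => b := by
  obtain ⟨cC, hsC, hC⟩ := hΛ.construct
  obtain ⟨cI, ⟨pI, hsI⟩, hI⟩ := hΛ.insert
  obtain ⟨cQ, ⟨pQ, hsQ⟩, hQ⟩ := hΛ.filterQuery
  have hl : PolyBounded id fun l => l := PolyBounded.param
  have hln : PolyBounded id fun l => l + n l := hl.add hn
  have hJ : PolyBounded id fun l => Λ.numFilters l (n l) :=
    hΛ.numFilters.comp (fun l => (l, n l)) hln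
  have hpI : PolyBounded id fun l => pI.eval (l + n l) :=
    PolyBounded.comp (par := id) ⟨pI, fun _ => le_rfl⟩ (fun l => l + n l) hln
  have hpQ : PolyBounded id fun l => pQ.eval (l + n l) :=
    PolyBounded.comp (par := id) ⟨pQ, fun _ => le_rfl⟩ (fun l => l + n l) hln
  have hc : ∀ c, PolyBounded (id : ℕ → ℕ) fun _ => c := fun c => PolyBounded.const c
  refine ⟨_, ?_, fun l => exists_distinguisher (hC l) (hI l) (sI := pI.eval (l + n l))
    (fun j hj => (hsI (l, j)).trans (PolyBounded.eval_mono pI (by simpa using hj.le)))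
    (hQ l (n l)) (sQ := pQ.eval (l + n l)) (fun j => hsQ ⟨l, n l, j⟩) (A.choose l) (A.attack l)⟩
  have hJQ := hJ.mul (hpQ.add (hc 5))
  exact (((hA.1.add (hsC.add (hn.mul ((hpI.add ((hc 3).mul hl)).add (hc 4))))).add
    ((hn.mul (((hc 2).mul hl).add (hc 1))).mul (hc 3))).add
    (hA.2.mul (hJQ.add (hc 5)))).add
    ((((hn.mul (((hc 22).mul hl).add (hc 12))).add
      (hA.2.mul (((hc 22).mul hl).add (hc 11)))).add hJQ).add (hc 14))

theorem secure_withPerm (hΛ : Λ.Efficient) {n : ℕ → ℕ} (t : ℕ → ℕ) (hn : PolyBounded id n)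
    {ε : ℕ → ℝ} (hε : Λ.FalsePositiveRate n ε) {negl : ℕ → ℝ}
    (hnegl : ∀ s : ℕ → ℕ, PolyBounded id s → ∀ᶠ l in atTop,
      ∀ D : Circuit (permSig l) Empty Unit, D.size ≤ s l →
        KeyedPerm.realProb F D - KeyedPerm.idealProb D ≤ negl l) :
    (Λ.withPerm F).Secure n t fun l => ε l + negl l := by
  intro A hA
  obtain ⟨s, hs, hD⟩ := exists_efficient_distinguishers hΛ hn hA
  filter_upwards [hnegl s hs, hε, eventually_lt_two_pow hn] with l hl hεl hnl
  obtain ⟨D, hDs, hD⟩ := hD l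
  have hfresh : ∀ L : Fin (n l) → Entry l, ∃ y, ∀ a, (L a).1 ≠ y := fun L => by
    by_contra! h
    have := Fintype.card_le_of_surjective (fun a => (L a).1) h
    simp at this
    omega
  have hreal : ((Λ.withPerm F).smash A (t l) l true).toReal ≤ KeyedPerm.realProb F D := by
    rw [realProb_eq hD]
    exact ENNReal.toReal_mono (PMF.apply_ne_top _ _) (smash_withPerm_le A (t l) l)
  have hideal : KeyedPerm.idealProb D ≤ ε l := by
    -- An arbitrary list, used only to obtain `0 ≤ ε l`.
    obtain ⟨y, hy⟩ := hfresh fun _ => (fun _ => false, none)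
    rw [idealProb_eq hD]
    refine ENNReal.toReal_le_of_le_ofReal (ENNReal.toReal_nonneg.trans (hεl _ y hy)) ?_
    rw [PMF.bind_comm]
    refine pmf_bind_apply_le _ _ _ fun w => ?_
    obtain ⟨z, hz⟩ := hfresh (decList w)
    exact uniform_permGame_le _ _ (fun L x hx =>
      le_ofReal_of_toReal_le (PMF.apply_ne_top _ _) (hεl L x hx)) hz
  have := hl D hDs
  linarith

end LSMScheme

theorem theorem3 (Λ : LSMScheme) (hΛ : Λ.IsLSMStore) (n t : ℕ → ℕ) (hn : PolyBounded id n)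
    (ε : ℕ → ℝ) (hε : Λ.FalsePositiveRate n ε) (F : KeyedPerm) (hF : F.IsPRP) :
    ∃ negl : ℕ → ℝ, Negligible negl ∧ ∃ Λ' : LSMScheme, Λ' = Λ.withPerm F ∧
      Λ'.IsLSMStore ∧
      Λ'.FalsePositiveRate n ε ∧
      (∀ l i, Λ'.filterMemory l i = Λ.filterMemory l i + l) ∧
      Λ'.Secure n t (fun l => ε l + negl l) := by
  obtain ⟨negl, hnegl, hadv⟩ := KeyedPerm.exists_negligible_advantage hF
  exact ⟨negl, hnegl, _, rfl, LSMScheme.isLSMStore_withPerm hΛ hF.1,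
    LSMScheme.falsePositiveRate_withPerm hε, LSMScheme.filterMemory_withPerm,
    LSMScheme.secure_withPerm hΛ.efficient t hn hε hadv⟩
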